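/- Let $F$ be a field. All nonassociative algebras are unital. For a nonassociative $F$-algebra $A$ with associator $(x,y,z)=(xy)z-x(yz)$, let $\mathrm{Nuc}(A)=\{x\in A : (x,A,A)=(A,x,A)=(A,A,x)=0\}$ be its nucleus, an associative $F$-algebra; let $\mathrm{Jac}$ denote the Jacobson radical, and put $\sigma(A)=\mathrm{Nuc}(A)/\mathrm{Jac}(\mathrm{Nuc}(A))$. The center of $A$ is the set of elements of $\mathrm{Nuc}(A)$ that commute with all elements of $A$. A module over a ring is minimally faithful if it is faithful and none of its proper sections (quotients of submodules, other than the module itself) is faithful. A nonzero finite dimensional nonassociative $F$-algebra $A$ with center $F\cdot 1$ is called semiassociative if there is an étale $F$-subalgebra $K\subseteq \mathrm{Nuc}(A)$ such that $A$ is minimally faithful as a module over $K\otimes_F K$ acting by $(k\otimes k')a=kak'$. An associative $F$-algebra $R$ is called separable if it is projective as a module over $R\otimes_F R^{\mathrm{op}}$. (1) If $A$ and $B$ are semiassociative $F$-algebras, then, as subspaces of $A\otimes_F B$, $$\mathrm{Jac}(\mathrm{Nuc}(A\otimes_F B))=\mathrm{Jac}(\mathrm{Nuc}(A))\otimes_F\mathrm{Nuc}(B)+\mathrm{Nuc}(A)\otimes_F\mathrm{Jac}(\mathrm{Nuc}(B)),$$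 and $\sigma(A\otimes_F B)\cong\sigma(A)\otimes_F\sigma(B)$ as $F$-algebras. (2) The isomorphism classes of semiassociative $F$-algebras form a monoid under $\otimes_F$, with identity the class of $F$, and so do the isomorphism classes of separable associative $F$-algebras; and $[A]\mapsto[\sigma(A)]$ is a well-defined monoid homomorphism from the former to the latter. -/

import Mathlib

open scoped TensorProduct

universe u v w

section Nucleus

variable (F : Type u) [Field F] (A : Type v) [NonAssocRing A] [Module F A]
  [SMulCommClass F A A] [IsScalarTower F A A]

/-- The nucleus of a (unital) nonassociative `F`-algebra `A`: the elements that associate with all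
pairs of elements of `A`, in the left, the middle and the right position. -/
def nucleus : Submodule F A where
  carrier := {x | (∀ a b : A, associator x a b = 0) ∧ (∀ a b : A, associator a x b = 0) ∧
    (∀ a b : A, associator a b x = 0)}
  zero_mem' := by simp [associator]
  add_mem' := by
    rintro x y ⟨hx1, hx2, hx3⟩ ⟨hy1, hy2, hy3⟩
    simp only [associator, sub_eq_zero, Set.mem_ofPred_eq] at *
    refine ⟨fun a b => ?_, fun a b => ?_, fun a b => ?_⟩ <;> simp [add_mul, mul_add, *]
  smul_mem' := by
    rintro c x ⟨hx1, hx2, hx3⟩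
    simp only [associator, sub_eq_zero, Set.mem_ofPred_eq] at *
    refine ⟨fun a b => ?_, fun a b => ?_, fun a b => ?_⟩ <;>
      simp [smul_mul_assoc, mul_smul_comm, *]

variable {F A} in
theorem mem_nucleus_iff {x : A} : x ∈ nucleus F A ↔ (∀ a b : A, x * a * b = x * (a * b)) ∧
    (∀ a b : A, a * x * b = a * (x * b)) ∧ (∀ a b : A, a * b * x = a * (b * x)) := by
  simp [nucleus, associator, sub_eq_zero]

theorem one_mem_nucleus : (1 : A) ∈ nucleus F A := by
  simp [mem_nucleus_iff]

variable {F A} in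
theorem mul_mem_nucleus {x y : A} (hx : x ∈ nucleus F A) (hy : y ∈ nucleus F A) :
    x * y ∈ nucleus F A := by
  rw [mem_nucleus_iff] at *
  obtain ⟨hx1, hx2, hx3⟩ := hx
  obtain ⟨hy1, hy2, hy3⟩ := hy
  refine ⟨fun a b => ?_, fun a b => ?_, fun a b => ?_⟩
  · rw [hx1, hx1, hy1, hx1]
  · rw [← hx2, hy2, hx2, ← hx1 y b]
  · rw [← hx2, hx3, hy3, ← hx2 b y, hy3]

/-- The nucleus is an associative ring with the operations of `A`. -/
instance nucleus.instRing : Ring (nucleus F A) where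
  __ := (inferInstance : AddCommGroup (nucleus F A))
  mul x y := ⟨x.1 * y.1, mul_mem_nucleus x.2 y.2⟩
  one := ⟨1, one_mem_nucleus F A⟩
  mul_assoc x y z := Subtype.ext ((mem_nucleus_iff.1 x.2).1 y.1 z.1)
  one_mul x := Subtype.ext (one_mul x.1)
  mul_one x := Subtype.ext (mul_one x.1)
  zero_mul x := Subtype.ext (zero_mul x.1)
  mul_zero x := Subtype.ext (mul_zero x.1)
  left_distrib x y z := Subtype.ext (mul_add x.1 y.1 z.1)
  right_distrib x y z := Subtype.ext (add_mul x.1 y.1 z.1)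

instance nucleus.instAlgebra : Algebra F (nucleus F A) :=
  Algebra.ofModule (fun c x y => Subtype.ext (smul_mul_assoc c x.1 y.1))
    (fun c x y => Subtype.ext (mul_smul_comm c x.1 y.1))

/-- The Jacobson radical of the nucleus of `A`, as a subspace of `A`. -/
def radNucleus : Submodule F A :=
  ((Ring.jacobson (nucleus F A)).restrictScalars F).map (nucleus F A).subtype

/-- `σ(A) = Nuc(A) / Jac(Nuc(A))`, an associative `F`-algebra. -/
abbrev SemisimpleQuotient : Type v :=
  nucleus F A ⧸ Ring.jacobson (nucleus F A)

end Nucleus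

/-- A module is minimally faithful if it is faithful and no section `P / Q` with `Q ≤ P ≤ M`,
other than `M` itself, is faithful. -/
def IsMinimallyFaithful (R : Type u) [Ring R] (M : Type v) [AddCommGroup M] [Module R M] : Prop :=
  FaithfulSMul R M ∧ ∀ Q P : Submodule R M, Q ≤ P → FaithfulSMul R (P ⧸ Q.submoduleOf P) →
    Q = ⊥ ∧ P = ⊤

section Semiassociative

open scoped IsMulCommutative

variable {F : Type u} [Field F] {A : Type v} [NonAssocRing A] [Module F A]
  [SMulCommClass F A A] [IsScalarTower F A A]

/-- Left multiplication of `A` by the elements of a subalgebra `K` of the nucleus. -/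
def nucleusLeftMul (K : Subalgebra F (nucleus F A)) : K →ₐ[F] Module.End F A :=
  AlgHom.ofLinearMap
    ((LinearMap.mul F A).comp ((nucleus F A).subtype.comp K.val.toLinearMap))
    (LinearMap.ext fun a => one_mul a)
    (fun x y => LinearMap.ext fun a => (mem_nucleus_iff.1 x.1.2).1 y.1.1 a)

/-- Right multiplication of `A` by the elements of a commutative subalgebra `K` of the nucleus. -/
def nucleusRightMul (K : Subalgebra F (nucleus F A)) [IsMulCommutative K] :
    K →ₐ[F] Module.End F A :=
  AlgHom.ofLinearMap
    ((LinearMap.mul F A).flip.comp ((nucleus F A).subtype.comp K.val.toLinearMap))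
    (LinearMap.ext fun a => mul_one a)
    (fun x y => LinearMap.ext fun a => by
      rw [mul_comm x y]
      exact ((mem_nucleus_iff.1 x.1.2).2.2 a y.1.1).symm)

/-- The action of `K ⊗ K` on `A` by `(k ⊗ k') a = k a k'`. -/
def nucleusBiMul (K : Subalgebra F (nucleus F A)) [IsMulCommutative K] :
    K ⊗[F] K →ₐ[F] Module.End F A :=
  Algebra.TensorProduct.lift (nucleusLeftMul K) (nucleusRightMul K)
    (fun x y => LinearMap.ext fun a => ((mem_nucleus_iff.1 x.1.2).1 a y.1.1).symm)

theorem nucleusBiMul_tmul (K : Subalgebra F (nucleus F A)) [IsMulCommutative K] (k k' : K)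
    (a : A) : nucleusBiMul K (k ⊗ₜ k') a = (k : nucleus F A) * a * (k' : nucleus F A) :=
  ((mem_nucleus_iff.1 k.1.2).1 a k'.1.1).symm

/-- `A` as a module over `K ⊗ K`. -/
abbrev nucleusBimodule (K : Subalgebra F (nucleus F A)) [IsMulCommutative K] :
    Module (K ⊗[F] K) A :=
  Module.compHom A (nucleusBiMul K).toRingHom

variable (F A) in
/-- Semiassociative algebras: finite dimensional central nonassociative `F`-algebras `A` that are
minimally faithful over `K ⊗ K` for some étale `F`-subalgebra `K` of the nucleus. -/
structure IsSemiassociative : Prop where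
  nontrivial : Nontrivial A
  finite : FiniteDimensional F A
  /-- The center is `F · 1`. (`Set.center` consists of the elements of the nucleus that commute
  with all elements.) -/
  central : Set.center A = Set.range (fun c : F => c • (1 : A))
  exists_etale : ∃ (K : Subalgebra F (nucleus F A)) (_ : IsMulCommutative K),
    Algebra.Etale F K ∧
      letI : Module (K ⊗[F] K) A := nucleusBimodule K
      IsMinimallyFaithful (K ⊗[F] K) A

end Semiassociative

/-- An associative `F`-algebra `R` is separable if it is projective as an `R ⊗ Rᵒᵖ`-module,
where `(r ⊗ s) x = r x s`. -/
def IsSeparableAlgebra (F : Type u) [Field F] (R : Type v) [Ring R] [Algebra F R] : Prop :=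
  letI : Module (R ⊗[F] Rᵐᵒᵖ) R := instModuleTensorProductMop F R
  Module.Projective (R ⊗[F] Rᵐᵒᵖ) R

/-- Bundled (unital) nonassociative `F`-algebras. -/
structure NonassocAlg (F : Type u) [Field F] where
  carrier : Type u
  [ring : NonAssocRing carrier]
  [module : Module F carrier]
  [smulComm : SMulCommClass F carrier carrier]
  [tower : IsScalarTower F carrier carrier]

/-- Bundled associative `F`-algebras. -/
structure AssocAlg (F : Type u) [Field F] where
  carrier : Type u
  [ring : Ring carrier]
  [algebra : Algebra F carrier]

attribute [instance] NonassocAlg.ring NonassocAlg.module NonassocAlg.smulComm NonassocAlg.tower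
attribute [instance] AssocAlg.ring AssocAlg.algebra

section Classes

variable (F : Type u) [Field F]

/-- Isomorphism of nonassociative algebras: a multiplicative linear equivalence. -/
def NonassocIso (A B : Type u) [NonAssocRing A] [Module F A] [NonAssocRing B] [Module F B] : Prop :=
  ∃ e : A ≃ₗ[F] B, ∀ x y, e (x * y) = e x * e y

instance NonassocAlg.setoid : Setoid (NonassocAlg F) where
  r A B := NonassocIso F A.carrier B.carrier
  iseqv :=
    { refl := fun A => ⟨LinearEquiv.refl F _, fun _ _ => rfl⟩
      symm := by
        rintro A B ⟨e, he⟩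
        exact ⟨e.symm, fun x y => e.injective (by simp [he])⟩
      trans := by
        rintro A B C ⟨e, he⟩ ⟨f, hf⟩
        exact ⟨e.trans f, fun x y => by simp [he, hf]⟩ }

/-- Isomorphism of associative algebras. -/
instance AssocAlg.setoid : Setoid (AssocAlg F) where
  r A B := Nonempty (A.carrier ≃ₐ[F] B.carrier)
  iseqv :=
    { refl := fun _ => ⟨AlgEquiv.refl⟩
      symm := fun ⟨e⟩ => ⟨e.symm⟩
      trans := fun ⟨e⟩ ⟨f⟩ => ⟨e.trans f⟩ }

/-- Isomorphism classes of nonassociative `F`-algebras. -/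
def NonassocClass : Type (u + 1) := Quotient (NonassocAlg.setoid F)

/-- Isomorphism classes of associative `F`-algebras. -/
def AssocClass : Type (u + 1) := Quotient (AssocAlg.setoid F)

variable {F}

/-- The isomorphism class of a nonassociative algebra. -/
def NonassocClass.mk (A : NonassocAlg F) : NonassocClass F := Quotient.mk _ A

/-- The isomorphism class of an associative algebra. -/
def AssocClass.mk (A : AssocAlg F) : AssocClass F := Quotient.mk _ A

/-- Tensor product over `F`. -/
def NonassocAlg.tensor (A B : NonassocAlg F) : NonassocAlg F := ⟨A.carrier ⊗[F] B.carrier⟩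

/-- Tensor product over `F`. -/
def AssocAlg.tensor (A B : AssocAlg F) : AssocAlg F := ⟨A.carrier ⊗[F] B.carrier⟩

section TensorIso

variable {A B C D : Type u}
  [NonAssocRing A] [Module F A] [SMulCommClass F A A] [IsScalarTower F A A]
  [NonAssocRing B] [Module F B] [SMulCommClass F B B] [IsScalarTower F B B]
  [NonAssocRing C] [Module F C] [SMulCommClass F C C] [IsScalarTower F C C]
  [NonAssocRing D] [Module F D] [SMulCommClass F D D] [IsScalarTower F D D]

theorem nonassocIso_of_tmul (e : A ⊗[F] B ≃ₗ[F] C)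
    (h : ∀ (a a' : A) (b b' : B), e ((a * a') ⊗ₜ (b * b')) = e (a ⊗ₜ b) * e (a' ⊗ₜ b')) :
    NonassocIso F (A ⊗[F] B) C := by
  refine ⟨e, fun x y => ?_⟩
  induction x using TensorProduct.induction_on with
  | zero => simp
  | add x x' hx hx' => simp [add_mul, hx, hx']
  | tmul a b =>
    induction y using TensorProduct.induction_on with
    | zero => simp
    | add y y' hy hy' => simp [mul_add, hy, hy']
    | tmul a' b' => simpa using h a a' b b'

theorem nonassocIso_congr (h : NonassocIso F A C) (h' : NonassocIso F B D) :
    NonassocIso F (A ⊗[F] B) (C ⊗[F] D) := by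
  obtain ⟨e, he⟩ := h
  obtain ⟨f, hf⟩ := h'
  exact nonassocIso_of_tmul (TensorProduct.congr e f) (by simp [he, hf])

theorem nonassocIso_assoc : NonassocIso F ((A ⊗[F] B) ⊗[F] C) (A ⊗[F] (B ⊗[F] C)) := by
  refine nonassocIso_of_tmul (TensorProduct.assoc F A B C) ?_
  intro x x' c c'
  induction x using TensorProduct.induction_on with
  | zero => simp
  | add x y hx hy => simp [add_mul, TensorProduct.add_tmul, hx, hy]
  | tmul a b =>
    induction x' using TensorProduct.induction_on with
    | zero => simp
    | add x y hx hy => simp [mul_add, TensorProduct.add_tmul, hx, hy]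
    | tmul a' b' => simp

theorem nonassocIso_comm : NonassocIso F (A ⊗[F] B) (B ⊗[F] A) :=
  nonassocIso_of_tmul (TensorProduct.comm F A B) (by simp)

theorem nonassocIso_lid : NonassocIso F (F ⊗[F] A) A := by
  refine nonassocIso_of_tmul (TensorProduct.lid F A) ?_
  intro a a' b b'
  simp [mul_comm a a', mul_smul, smul_mul_assoc, mul_smul_comm]

theorem nonassocIso_rid : NonassocIso F (A ⊗[F] F) A := by
  refine nonassocIso_of_tmul (TensorProduct.rid F A) ?_
  intro a a' b b'
  simp [mul_comm b b', mul_smul, smul_mul_assoc, mul_smul_comm]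

end TensorIso

/-- The commutative monoid of isomorphism classes of nonassociative `F`-algebras under the tensor
product over `F`, with identity the class of `F`. -/
instance NonassocClass.instCommMonoid : CommMonoid (NonassocClass F) where
  mul := Quotient.map₂ NonassocAlg.tensor (fun _ _ h _ _ h' => nonassocIso_congr h h')
  one := NonassocClass.mk ⟨F⟩
  mul_assoc := by
    rintro ⟨A⟩ ⟨B⟩ ⟨C⟩
    exact Quotient.sound nonassocIso_assoc
  one_mul := by
    rintro ⟨A⟩
    exact Quotient.sound nonassocIso_lid
  mul_one := by
    rintro ⟨A⟩
    exact Quotient.sound nonassocIso_rid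
  mul_comm := by
    rintro ⟨A⟩ ⟨B⟩
    exact Quotient.sound nonassocIso_comm

/-- The commutative monoid of isomorphism classes of associative `F`-algebras under the tensor
product over `F`, with identity the class of `F`. -/
instance AssocClass.instCommMonoid : CommMonoid (AssocClass F) where
  mul := Quotient.map₂ AssocAlg.tensor (by
    rintro A A' ⟨e⟩ B B' ⟨f⟩
    exact ⟨Algebra.TensorProduct.congr e f⟩)
  one := AssocClass.mk ⟨F⟩
  mul_assoc := by
    rintro ⟨A⟩ ⟨B⟩ ⟨C⟩
    exact Quotient.sound ⟨Algebra.TensorProduct.assoc F F F A.carrier B.carrier C.carrier⟩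
  one_mul := by
    rintro ⟨A⟩
    exact Quotient.sound ⟨Algebra.TensorProduct.lid F A.carrier⟩
  mul_one := by
    rintro ⟨A⟩
    exact Quotient.sound ⟨Algebra.TensorProduct.rid F F A.carrier⟩
  mul_comm := by
    rintro ⟨A⟩ ⟨B⟩
    exact Quotient.sound ⟨Algebra.TensorProduct.comm F A.carrier B.carrier⟩

/-- `σ(A)` as a bundled associative algebra. -/
def NonassocAlg.sigma (A : NonassocAlg F) : AssocAlg F := ⟨SemisimpleQuotient F A.carrier⟩

end Classes

/-!
Let `K` be the étale subalgebra of a semiassociative algebra `A`. Since `K ⊗ K` is a finite product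
of fields, a minimally faithful module over it is free of rank one, so `A = K a K` for some `a`.
Hence the elements of `A` commuting with `K` are a rank one module over the diagonal, which forces
`K` to be its own centralizer in `Nuc(A)`. Averaging by the separability idempotent of `K` lifts
centralizing elements along surjections, so `K` is also its own centralizer in `σ(A)`.

If `S` is semisimple, `T` is any algebra and `K ⊆ S` is self-centralizing, then every nonzero
two-sided ideal of `S ⊗ T` meets `K ⊗ T`: the coefficients of its elements at a fixed basis element
of `T` form a two-sided ideal of `S`, which contains a nonzero central idempotent, and the average
of an element with that coefficient is again nonzero. Applied in both factors to the Jacobson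
radical of `S ⊗ S'`, this produces nilpotent elements of the reduced ring `K ⊗ K'`; hence
`σ(A) ⊗ σ(B)` is semisimple, and `σ(A)` is separable (take `S' = σ(A)ᵐᵒᵖ`). Everything else follows
from `Nuc(A ⊗ B) = Nuc(A) ⊗ Nuc(B)`.
-/

section MinimallyFaithful

variable {T : Type*} [CommRing T] {M : Type*} [AddCommGroup M] [Module T M]

theorem torsionOf_add_smul_of_isIdempotentElem {e : T} (he : IsIdempotentElem e) {m : M}
    (hem : e • m = 0) (m' : M) :
    Ideal.torsionOf T M (m + e • m') = Ideal.torsionOf T M m ⊓ Ideal.torsionOf T M (e • m') := by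
  ext t
  simp only [Submodule.mem_inf, Ideal.mem_torsionOf_iff, smul_add]
  refine ⟨fun h => ?_, fun ⟨hm, hm'⟩ => by rw [hm, hm', add_zero]⟩
  have hm' : t • e • m' = 0 := by
    simpa only [smul_add, smul_comm e t, hem, smul_smul e e, he.eq, smul_zero, zero_add]
      using congrArg (e • ·) h
  exact ⟨by rwa [hm', add_zero] at h, hm'⟩

theorem exists_torsionOf_eq_bot [IsSemisimpleRing T] (M : Type*) [AddCommGroup M] [Module T M]
    [FaithfulSMul T M] : ∃ m : M, Ideal.torsionOf T M m = ⊥ := by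
  obtain ⟨_, ⟨m, rfl⟩, hmin⟩ := wellFounded_lt.has_min
    (Set.range (Ideal.torsionOf T M)) (Set.range_nonempty _)
  obtain ⟨e, he, hspan⟩ := IsSemisimpleRing.ideal_eq_span_idempotent (Ideal.torsionOf T M m)
  have hem : e • m = 0 := (Ideal.mem_torsionOf_iff m e).1 (hspan ▸ Ideal.mem_span_singleton_self e)
  have e_smul (m' : M) : e • m' = 0 := by
    have hinf := torsionOf_add_smul_of_isIdempotentElem he hem m'
    have heq := eq_of_le_of_not_lt (hinf.trans_le inf_le_left) (hmin _ ⟨_, rfl⟩)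
    have hmem := inf_eq_left.1 (hinf.symm.trans heq) ((Ideal.mem_torsionOf_iff m e).2 hem)
    rwa [Ideal.mem_torsionOf_iff, smul_smul, he.eq] at hmem
  have he0 : e = 0 := FaithfulSMul.eq_of_smul_eq_smul (α := M) fun m' => by
    rw [e_smul, zero_smul]
  exact ⟨m, by rw [hspan, he0, Ideal.span_singleton_eq_bot]⟩

theorem smul_injective_iff_torsionOf_eq_bot {m : M} :
    (Function.Injective fun t : T => t • m) ↔ Ideal.torsionOf T M m = ⊥ :=
  (LinearMap.ker_eq_bot (f := LinearMap.toSpanSingleton T M m)).symm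

theorem IsMinimallyFaithful.exists_smul_bijective [IsSemisimpleRing T]
    (h : IsMinimallyFaithful T M) : ∃ m : M, Function.Bijective fun t : T => t • m := by
  obtain ⟨_, hmin⟩ := h
  obtain ⟨m, hm⟩ := exists_torsionOf_eq_bot (T := T) M
  have hinj := smul_injective_iff_torsionOf_eq_bot.2 hm
  have hspan : T ∙ m = ⊤ := by
    refine (hmin ⊥ (T ∙ m) bot_le ⟨fun {s t} hst => hinj ?_⟩).2
    have := hst (Submodule.Quotient.mk ⟨m, Submodule.mem_span_singleton_self m⟩)
    rw [← Submodule.Quotient.mk_smul, ← Submodule.Quotient.mk_smul, Submodule.Quotient.eq,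
      Submodule.submoduleOf, Submodule.mem_comap, Submodule.mem_bot] at this
    simpa [sub_eq_zero] using this
  exact ⟨m, hinj, fun a => Submodule.mem_span_singleton.1 (hspan ▸ Submodule.mem_top)⟩

theorem isMinimallyFaithful_of_smul_bijective [IsSemisimpleRing T] {m : M}
    (hm : Function.Bijective fun t : T => t • m) : IsMinimallyFaithful T M := by
  refine ⟨⟨fun {s t} hst => hm.1 (hst m)⟩, fun Q P _ _ => ?_⟩
  obtain ⟨x, hx⟩ := exists_torsionOf_eq_bot (T := T) (P ⧸ Q.submoduleOf P)
  obtain ⟨p, rfl⟩ := (Q.submoduleOf P).mkQ_surjective x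
  have smul_mem_imp {t : T} (ht : t • (p : M) ∈ Q) : t = 0 := by
    rw [← Ideal.mem_bot, ← hx, Ideal.mem_torsionOf_iff, ← map_smul, ← LinearMap.mem_ker,
      Submodule.ker_mkQ]
    exact ht
  let toM : T ≃ₗ[T] M := LinearEquiv.ofBijective (LinearMap.toSpanSingleton T M m) hm
  have hsurj : Function.Surjective fun t : T => t • (p : M) := by
    have hinj : Function.Injective (toM.symm.toLinearMap ∘ₗ LinearMap.toSpanSingleton T M p) := by
      refine toM.symm.injective.comp ((injective_iff_map_eq_zero _).2 fun t ht => ?_)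
      exact smul_mem_imp ((show t • (p : M) = 0 from ht) ▸ Q.zero_mem)
    exact (EquivLike.comp_surjective _ toM.symm).1
      (IsArtinian.surjective_of_injective_endomorphism _ hinj)
  constructor
  · refine (Submodule.eq_bot_iff Q).2 fun a ha => ?_
    obtain ⟨t, rfl⟩ := hsurj a
    exact (congrArg (· • (p : M)) (smul_mem_imp ha)).trans (zero_smul T _)
  · refine Submodule.eq_top_iff'.2 fun a => ?_
    obtain ⟨t, rfl⟩ := hsurj a
    exact P.smul_mem t p.2

end MinimallyFaithful

section BimoduleInvariants

open Algebra.FormallyUnramified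

variable {F K M : Type*} [CommRing F] [CommRing K] [Algebra F K] [AddCommGroup M] [Module F M]
  (ρ : K ⊗[F] K →ₐ[F] Module.End F M)

/-- The elements of a `K`-bimodule on which the left and the right action of `K` agree; the
bimodule structure is given as an action `ρ` of `K ⊗ K`. -/
def bimoduleInvariants : Submodule F M where
  carrier := {m | ∀ k : K, ρ (k ⊗ₜ 1) m = ρ (1 ⊗ₜ k) m}
  zero_mem' k := by simp only [map_zero]
  add_mem' hx hy k := by simp only [map_add, hx k, hy k]
  smul_mem' c x hx k := by simp only [map_smul, hx k]

variable {ρ}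

theorem mem_bimoduleInvariants_iff {m : M} :
    m ∈ bimoduleInvariants ρ ↔ ∀ k : K, ρ (k ⊗ₜ 1) m = ρ (1 ⊗ₜ k) m :=
  Iff.rfl

theorem apply_of_mem_bimoduleInvariants {m : M} (hm : m ∈ bimoduleInvariants ρ) (z : K ⊗[F] K) :
    ρ z m = ρ (Algebra.TensorProduct.lmul' F z ⊗ₜ 1) m := by
  induction z with
  | zero => simp
  | add x y hx hy => simp [hx, hy, TensorProduct.add_tmul]
  | tmul k k' =>
    calc ρ (k ⊗ₜ k') m = ρ (k ⊗ₜ 1) (ρ (1 ⊗ₜ k') m) := by simp [← Module.End.mul_apply, ← map_mul]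
      _ = ρ (k ⊗ₜ 1) (ρ (k' ⊗ₜ 1) m) := by rw [hm k']
      _ = ρ (Algebra.TensorProduct.lmul' F (k ⊗ₜ k') ⊗ₜ 1) m := by
        simp [← Module.End.mul_apply, ← map_mul]

variable [Algebra.FormallyUnramified F K] [Algebra.EssFiniteType F K]

variable (ρ) in
theorem elem_apply_mem_bimoduleInvariants (m : M) : ρ (elem F K) m ∈ bimoduleInvariants ρ :=
  fun k => by rw [← Module.End.mul_apply, ← Module.End.mul_apply, ← map_mul, ← map_mul,
    one_tmul_mul_elem]

theorem elem_apply_of_mem_bimoduleInvariants {m : M} (hm : m ∈ bimoduleInvariants ρ) :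
    ρ (elem F K) m = m := by
  rw [apply_of_mem_bimoduleInvariants hm, lmul_elem, ← Algebra.TensorProduct.one_def, map_one,
    Module.End.one_apply]

end BimoduleInvariants

section JacobsonRadical

theorem mem_jacobson_of_forall_isNilpotent_mul {R : Type*} [Ring R] {x : R}
    (hx : ∀ a : R, IsNilpotent (a * x)) : x ∈ Ring.jacobson R := by
  rw [← Ideal.jacobson_bot, Ideal.mem_jacobson_iff]
  intro a
  obtain ⟨z, hz⟩ := (hx a).isUnit_one_add.exists_left_inv
  exact ⟨z, by rw [Submodule.mem_bot, mul_assoc, sub_eq_zero, ← hz, mul_add, mul_one, add_comm]⟩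

theorem ker_eq_jacobson_of_surjective {R S : Type*} [Ring R] [Ring S] [IsSemisimpleRing S]
    {f : R →+* S} (hf : Function.Surjective f) (hker : RingHom.ker f ≤ Ring.jacobson R) :
    RingHom.ker f = Ring.jacobson R := by
  have : RingHomSurjective f := ⟨hf⟩
  refine hker.antisymm fun x hx => ?_
  simpa [IsSemisimpleRing.jacobson_eq_bot] using Ring.le_comap_jacobson f hx

/-- The central element is the identity of the ideal `I`: if `I = S f` with `f` idempotent, then
`s f - f s f` generates a nil left ideal. -/
theorem exists_central_mem_of_ne_bot {S : Type*} [Ring S] [IsSemisimpleRing S] {I : Ideal S}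
    [I.IsTwoSided] (hI : I ≠ ⊥) : ∃ f ∈ I, f ≠ 0 ∧ ∀ s, Commute f s := by
  obtain ⟨f, hf, rfl⟩ := IsSemisimpleRing.ideal_eq_span_idempotent I
  have hfI : f ∈ Ideal.span {f} := Ideal.mem_span_singleton_self f
  have mul_f {x : S} (hx : x ∈ Ideal.span {f}) : x * f = x := by
    obtain ⟨a, rfl⟩ := Ideal.mem_span_singleton'.1 hx
    rw [mul_assoc, hf.eq]
  refine ⟨f, hfI, fun h0 => hI (Ideal.span_singleton_eq_bot.2 h0), fun s => ?_⟩
  have nil_left_ideal (a : S) : IsNilpotent (a * (s * f - f * s * f)) := by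
    have hyI : s * f - f * s * f ∈ Ideal.span {f} :=
      sub_mem (Ideal.mul_mem_left _ _ hfI) (Ideal.mul_mem_left _ _ hfI)
    have hfy : f * (s * f - f * s * f) = 0 := by
      simp only [mul_sub, ← mul_assoc, hf.eq, sub_self]
    refine ⟨2, ?_⟩
    rw [pow_two, mul_assoc, ← mul_assoc _ a, ← mul_f (Ideal.mul_mem_right a _ hyI), mul_assoc _ f,
      hfy, mul_zero, mul_zero]
  have hmem := mem_jacobson_of_forall_isNilpotent_mul nil_left_ideal
  rw [IsSemisimpleRing.jacobson_eq_bot, Submodule.mem_bot, sub_eq_zero,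
    mul_f (Ideal.mul_mem_right s _ hfI)] at hmem
  exact hmem.symm

end JacobsonRadical

section JacobsonTensor

theorem ker_tensorProduct_map {F V V' W W' : Type*} [CommRing F] [AddCommGroup V] [Module F V]
    [AddCommGroup V'] [Module F V'] [AddCommGroup W] [Module F W] [AddCommGroup W'] [Module F W']
    {f : V →ₗ[F] V'} {g : W →ₗ[F] W'} (hf : Function.Surjective f) (hg : Function.Surjective g) :
    LinearMap.ker (TensorProduct.map f g) =
      Submodule.map₂ (TensorProduct.mk F V W) (LinearMap.ker f) ⊤ ⊔
        Submodule.map₂ (TensorProduct.mk F V W) ⊤ (LinearMap.ker g) := by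
  rw [TensorProduct.map_ker f.exact_subtype_ker_map hf g.exact_subtype_ker_map hg, sup_comm,
    LinearMap.lTensor, LinearMap.rTensor, TensorProduct.range_map, TensorProduct.range_map,
    Submodule.range_subtype, Submodule.range_subtype, LinearMap.range_id, LinearMap.range_id]

variable {F R R' : Type*} [CommRing F] [Ring R] [Algebra F R] [Ring R'] [Algebra F R']

theorem tmul_mem_jacobson_of_left (hnil : IsNilpotent (Ring.jacobson R)) {j : R}
    (hj : j ∈ Ring.jacobson R) (r : R') : j ⊗ₜ[F] r ∈ Ring.jacobson (R ⊗[F] R') := by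
  let J : Submodule F (R ⊗[F] R') := ((Ring.jacobson R).restrictScalars F).map
    (Algebra.TensorProduct.includeLeft : R →ₐ[F] R ⊗[F] R').toLinearMap
  let T : Submodule F (R ⊗[F] R') := (⊤ : Submodule F R').map
    (Algebra.TensorProduct.includeRight : R' →ₐ[F] R ⊗[F] R').toLinearMap
  have tmul_mem {a : R} (ha : a ∈ Ring.jacobson R) (b : R') : a ⊗ₜ[F] b ∈ J * T := by
    rw [← mul_one a, ← one_mul b, ← Algebra.TensorProduct.tmul_mul_tmul]
    exact Submodule.mul_mem_mul ⟨a, ha, rfl⟩ ⟨b, Submodule.mem_top, rfl⟩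
  have mul_mem (c : R ⊗[F] R') : c * j ⊗ₜ r ∈ J * T := by
    induction c with
    | zero => simp
    | add x y hx hy => simpa [add_mul] using add_mem hx hy
    | tmul a b =>
      rw [Algebra.TensorProduct.tmul_mul_tmul]
      exact tmul_mem (Ideal.mul_mem_left _ a hj) _
  obtain ⟨n, hn⟩ := hnil
  have hJ : J ^ (n + 1) = ⊥ := by
    rw [← Submodule.map_pow, ← Submodule.restrictScalars_pow n.succ_ne_zero, Submodule.pow_succ,
      hn]
    simp
  have hcomm : Commute J T := by
    refine Submodule.mul_comm_of_commute ?_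
    rintro _ ⟨a, _, rfl⟩ _ ⟨b, _, rfl⟩
    simp [Commute, SemiconjBy]
  refine mem_jacobson_of_forall_isNilpotent_mul fun c => ⟨n + 1, ?_⟩
  have := Submodule.pow_mem_pow _ (mul_mem c) (n + 1)
  rwa [hcomm.mul_pow, hJ, Submodule.bot_mul, Submodule.mem_bot] at this

theorem tmul_mem_jacobson_of_right (hnil : IsNilpotent (Ring.jacobson R')) (r : R) {j : R'}
    (hj : j ∈ Ring.jacobson R') : r ⊗ₜ[F] j ∈ Ring.jacobson (R ⊗[F] R') := by
  let e := (Algebra.TensorProduct.comm F R' R).toRingEquiv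
  have : RingHomSurjective e.toRingHom := ⟨e.surjective⟩
  exact Ring.le_comap_jacobson e.toRingHom (tmul_mem_jacobson_of_left hnil hj r)

variable (F R R') in
/-- The projection of `R ⊗ R'` onto the tensor product of the quotients of `R` and `R'` by their
Jacobson radicals. -/
noncomputable def tensorJacobsonProj :
    R ⊗[F] R' →ₐ[F] (R ⧸ Ring.jacobson R) ⊗[F] (R' ⧸ Ring.jacobson R') :=
  Algebra.TensorProduct.map (Ideal.Quotient.mkₐ F _) (Ideal.Quotient.mkₐ F _)

theorem tensorJacobsonProj_surjective : Function.Surjective (tensorJacobsonProj F R R') :=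
  TensorProduct.map_surjective (Ideal.Quotient.mkₐ_surjective F _)
    (Ideal.Quotient.mkₐ_surjective F _)

theorem ker_mkₐ_toLinearMap (I : Ideal R) [I.IsTwoSided] :
    LinearMap.ker (Ideal.Quotient.mkₐ F I).toLinearMap = I.restrictScalars F := by
  ext x
  simp [Ideal.Quotient.eq_zero_iff_mem]

theorem ker_tensorJacobsonProj_eq_sup :
    LinearMap.ker (tensorJacobsonProj F R R').toLinearMap =
      Submodule.map₂ (TensorProduct.mk F R R') ((Ring.jacobson R).restrictScalars F) ⊤ ⊔
        Submodule.map₂ (TensorProduct.mk F R R') ⊤ ((Ring.jacobson R').restrictScalars F) :=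
  (ker_tensorProduct_map (Ideal.Quotient.mkₐ_surjective F _)
    (Ideal.Quotient.mkₐ_surjective F _)).trans (by rw [ker_mkₐ_toLinearMap, ker_mkₐ_toLinearMap])

theorem ker_tensorJacobsonProj [IsSemiprimaryRing R] [IsSemiprimaryRing R']
    [IsSemisimpleRing ((R ⧸ Ring.jacobson R) ⊗[F] (R' ⧸ Ring.jacobson R'))] :
    RingHom.ker (tensorJacobsonProj F R R') = Ring.jacobson (R ⊗[F] R') := by
  refine ker_eq_jacobson_of_surjective tensorJacobsonProj_surjective ?_
  change LinearMap.ker (tensorJacobsonProj F R R').toLinearMap ≤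
    (Ring.jacobson (R ⊗[F] R')).restrictScalars F
  rw [ker_tensorJacobsonProj_eq_sup, sup_le_iff, Submodule.map₂_le, Submodule.map₂_le]
  exact ⟨fun j hj r _ => tmul_mem_jacobson_of_left IsSemiprimaryRing.isNilpotent hj r,
    fun r _ j hj => tmul_mem_jacobson_of_right IsSemiprimaryRing.isNilpotent r hj⟩

theorem jacobson_tensorProduct [IsSemiprimaryRing R] [IsSemiprimaryRing R']
    [IsSemisimpleRing ((R ⧸ Ring.jacobson R) ⊗[F] (R' ⧸ Ring.jacobson R'))] :
    (Ring.jacobson (R ⊗[F] R')).restrictScalars F =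
      Submodule.map₂ (TensorProduct.mk F R R') ((Ring.jacobson R).restrictScalars F) ⊤ ⊔
        Submodule.map₂ (TensorProduct.mk F R R') ⊤ ((Ring.jacobson R').restrictScalars F) := by
  rw [← ker_tensorJacobsonProj_eq_sup, ← ker_tensorJacobsonProj]
  rfl

end JacobsonTensor

section Slice

variable {F V W : Type*} [CommRing F] [AddCommGroup V] [Module F V] [AddCommGroup W] [Module F W]

variable (V) in
/-- Contraction of the right factor of `V ⊗ W` with a linear functional `φ`: the slice map
`v ⊗ w ↦ φ w • v`. -/
noncomputable def slice (φ : W →ₗ[F] F) : V ⊗[F] W →ₗ[F] V :=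
  (TensorProduct.rid F V).toLinearMap ∘ₗ φ.lTensor V

@[simp]
theorem slice_tmul (φ : W →ₗ[F] F) (v : V) (w : W) : slice V φ (v ⊗ₜ w) = φ w • v := by
  simp [slice]

theorem slice_rTensor {V' : Type*} [AddCommGroup V'] [Module F V'] (f : V →ₗ[F] V')
    (φ : W →ₗ[F] F) (x : V ⊗[F] W) : slice V' φ (f.rTensor W x) = f (slice V φ x) := by
  induction x with
  | zero => simp
  | add x y hx hy => simp [hx, hy]
  | tmul v w => simp

theorem ext_slice [Module.Free F W] {x y : V ⊗[F] W}
    (h : ∀ φ : W →ₗ[F] F, slice V φ x = slice V φ y) : x = y := by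
  classical
  let b := Module.Free.chooseBasis F W
  have coeff_eq_slice (z : V ⊗[F] W) (i) :
      TensorProduct.equivFinsuppOfBasisRight b z i = slice V (b.coord i) z := by
    induction z with
    | zero => simp
    | add z w hz hw => simp [hz, hw]
    | tmul v w => simp
  refine (TensorProduct.equivFinsuppOfBasisRight b).injective (Finsupp.ext fun i => ?_)
  rw [coeff_eq_slice, coeff_eq_slice, h]

theorem exists_slice_ne_zero [Module.Free F W] {x : V ⊗[F] W} (hx : x ≠ 0) :
    ∃ φ : W →ₗ[F] F, slice V φ x ≠ 0 := by
  contrapose! hx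
  exact ext_slice fun φ => by rw [hx, map_zero]

theorem rTensor_eq_self_of_slice [Module.Free F W] {π : V →ₗ[F] V} {x : V ⊗[F] W}
    (hx : ∀ φ : W →ₗ[F] F, π (slice V φ x) = slice V φ x) : π.rTensor W x = x :=
  ext_slice fun φ => by rw [slice_rTensor, hx]

theorem lTensor_eq_self_of_slice [Module.Free F V] {π : W →ₗ[F] W} {x : V ⊗[F] W}
    (hx : ∀ φ : V →ₗ[F] F, π (slice W φ (TensorProduct.comm F V W x)) =
      slice W φ (TensorProduct.comm F V W x)) : π.lTensor V x = x := by
  rw [← LinearMap.comm_comp_rTensor_comp_comm_eq, LinearMap.comp_apply, LinearMap.comp_apply,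
    LinearEquiv.coe_coe, LinearEquiv.coe_coe, rTensor_eq_self_of_slice hx,
    TensorProduct.comm_comm]

end Slice

section SliceField

variable {F V W : Type*} [Field F] [AddCommGroup V] [Module F V] [AddCommGroup W] [Module F W]

theorem mem_range_rTensor_of_slice {V' : Type*} [AddCommGroup V'] [Module F V']
    {f : V' →ₗ[F] V} (hf : Function.Injective f) {x : V ⊗[F] W}
    (hx : ∀ φ : W →ₗ[F] F, slice V φ x ∈ LinearMap.range f) :
    x ∈ LinearMap.range (f.rTensor W) := by
  obtain ⟨r, hr⟩ := f.exists_leftInverse_of_injective (LinearMap.ker_eq_bot.2 hf)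
  have hπ : (f ∘ₗ r).rTensor W x = x := rTensor_eq_self_of_slice fun φ => by
    obtain ⟨v, hv⟩ := hx φ
    rw [← hv, LinearMap.comp_apply, ← LinearMap.comp_apply r, hr, LinearMap.id_apply]
  exact ⟨r.rTensor W x, by rwa [LinearMap.rTensor_comp, LinearMap.comp_apply] at hπ⟩

theorem mem_range_mapIncl_of_slice {P : Submodule F V} {Q : Submodule F W} {x : V ⊗[F] W}
    (hP : ∀ φ : W →ₗ[F] F, slice V φ x ∈ P)
    (hQ : ∀ φ : V →ₗ[F] F, slice W φ (TensorProduct.comm F V W x) ∈ Q) :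
    x ∈ LinearMap.range (TensorProduct.mapIncl P Q) := by
  obtain ⟨p, hp⟩ := P.subtype.exists_leftInverse_of_injective P.ker_subtype
  obtain ⟨q, hq⟩ := Q.subtype.exists_leftInverse_of_injective Q.ker_subtype
  have hpx : (P.subtype ∘ₗ p).rTensor W x = x := rTensor_eq_self_of_slice fun φ =>
    congrArg Subtype.val (LinearMap.congr_fun hp ⟨_, hP φ⟩)
  have hqx : (Q.subtype ∘ₗ q).lTensor V x = x := lTensor_eq_self_of_slice fun φ =>
    congrArg Subtype.val (LinearMap.congr_fun hq ⟨_, hQ φ⟩)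
  refine ⟨TensorProduct.map p q x, ?_⟩
  rw [TensorProduct.mapIncl, ← LinearMap.comp_apply, ← TensorProduct.map_comp,
    ← LinearMap.rTensor_comp_lTensor, LinearMap.comp_apply, hqx, hpx]

end SliceField

section TensorAlgebra

variable {F : Type*} [CommRing F] {A B : Type*}
  [NonAssocRing A] [Module F A] [SMulCommClass F A A] [IsScalarTower F A A]
  [NonAssocRing B] [Module F B] [SMulCommClass F B B] [IsScalarTower F B B]

@[simp]
theorem slice_tmul_one_mul (φ : B →ₗ[F] F) (a : A) (x : A ⊗[F] B) :
    slice A φ (a ⊗ₜ 1 * x) = a * slice A φ x := by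
  induction x with
  | zero => simp
  | add x y hx hy => simp [mul_add, hx, hy]
  | tmul a' b => simp [mul_smul_comm]

@[simp]
theorem slice_mul_tmul_one (φ : B →ₗ[F] F) (x : A ⊗[F] B) (a : A) :
    slice A φ (x * a ⊗ₜ 1) = slice A φ x * a := by
  induction x with
  | zero => simp
  | add x y hx hy => simp [add_mul, hx, hy]
  | tmul a' b => simp [smul_mul_assoc]

theorem tensorProduct_comm_mul (x y : A ⊗[F] B) :
    TensorProduct.comm F A B (x * y) = TensorProduct.comm F A B x * TensorProduct.comm F A B y := by
  induction x with
  | zero => simp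
  | add x x' hx hx' => simp [add_mul, hx, hx']
  | tmul a b =>
    induction y with
    | zero => simp
    | add y y' hy hy' => simp [mul_add, hy, hy']
    | tmul a' b' => simp

end TensorAlgebra

section SelfCentralizing

open Algebra.FormallyUnramified

variable {F K S : Type*} [CommRing F] [CommRing K] [Algebra F K] [Ring S] [Algebra F S]

/-- A commutative algebra `K` mapping to `S` is self-centralizing if every element of `S` that
commutes with the image of `K` lies in that image. -/
def IsSelfCentralizing (ι : K →ₐ[F] S) : Prop :=
  ∀ s, (∀ k, Commute (ι k) s) → s ∈ ι.range

theorem IsSelfCentralizing.op {ι : K →ₐ[F] S} (hι : IsSelfCentralizing ι) :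
    IsSelfCentralizing (ι.op.comp (AlgEquiv.toOpposite F K).toAlgHom) := by
  intro s hs
  obtain ⟨k, hk⟩ := hι s.unop fun k => (hs k).unop
  exact ⟨k, MulOpposite.unop_injective hk⟩

/-- The action of `K ⊗ K` on an associative algebra `S` over `K` by
`(k ⊗ k') • s = ι k * s * ι k'`. -/
noncomputable def bimulHom (ι : K →ₐ[F] S) : K ⊗[F] K →ₐ[F] Module.End F S :=
  (AlgHom.mulLeftRight F S).comp
    (Algebra.TensorProduct.map ι (ι.op.comp (AlgEquiv.toOpposite F K).toAlgHom))

@[simp]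
theorem bimulHom_tmul (ι : K →ₐ[F] S) (k k' : K) (s : S) :
    bimulHom ι (k ⊗ₜ k') s = ι k * s * ι k' := by
  simp [bimulHom]

theorem mem_bimoduleInvariants_bimulHom_iff {ι : K →ₐ[F] S} {s : S} :
    s ∈ bimoduleInvariants (bimulHom ι) ↔ ∀ k, Commute (ι k) s := by
  simp [mem_bimoduleInvariants_iff, Commute, SemiconjBy]

theorem map_bimulHom {S' : Type*} [Ring S'] [Algebra F S'] (f : S →ₐ[F] S') (ι : K →ₐ[F] S)
    (z : K ⊗[F] K) (s : S) : f (bimulHom ι z s) = bimulHom (f.comp ι) z (f s) := by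
  induction z with
  | zero => simp
  | add x y hx hy => simp [hx, hy]
  | tmul k k' => simp

theorem slice_bimulHom {T : Type*} [Ring T] [Algebra F T] (φ : T →ₗ[F] F) (ι : K →ₐ[F] S)
    (z : K ⊗[F] K) (x : S ⊗[F] T) :
    slice S φ (bimulHom (Algebra.TensorProduct.includeLeft.comp ι) z x) =
      bimulHom ι z (slice S φ x) := by
  induction z with
  | zero => simp
  | add x y hx hy => simp [hx, hy]
  | tmul k k' => simp

theorem bimulHom_apply_mem (ι : K →ₐ[F] S) (I : Ideal S) [I.IsTwoSided] (z : K ⊗[F] K) {s : S}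
    (hs : s ∈ I) : bimulHom ι z s ∈ I := by
  induction z with
  | zero => simp
  | add x y hx hy => simpa using I.add_mem hx hy
  | tmul k k' => simpa using I.mul_mem_right _ (I.mul_mem_left _ hs)

theorem IsSelfCentralizing.bimulHom_elem_mem_range [Algebra.FormallyUnramified F K]
    [Algebra.EssFiniteType F K] {ι : K →ₐ[F] S} (hι : IsSelfCentralizing ι) (s : S) :
    bimulHom ι (elem F K) s ∈ ι.range :=
  hι _ (mem_bimoduleInvariants_bimulHom_iff.1 (elem_apply_mem_bimoduleInvariants _ s))

theorem IsSelfCentralizing.comp_of_surjective [Algebra.FormallyUnramified F K]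
    [Algebra.EssFiniteType F K] {ι : K →ₐ[F] S} (hι : IsSelfCentralizing ι)
    {S' : Type*} [Ring S'] [Algebra F S'] {f : S →ₐ[F] S'} (hf : Function.Surjective f) :
    IsSelfCentralizing (f.comp ι) := by
  intro s' hs'
  obtain ⟨s, rfl⟩ := hf s'
  obtain ⟨k, hk⟩ := hι.bimulHom_elem_mem_range s
  refine ⟨k, (congrArg f hk).trans ?_⟩
  rw [map_bimulHom, elem_apply_of_mem_bimoduleInvariants
    (mem_bimoduleInvariants_bimulHom_iff.2 hs')]

/-- The ideal of all coefficients at `φ` of the elements of a left ideal of `S ⊗ T`. -/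
noncomputable def sliceIdeal {T : Type*} [Ring T] [Algebra F T] (φ : T →ₗ[F] F)
    (I : Ideal (S ⊗[F] T)) : Ideal S where
  __ := (I.restrictScalars F).map (slice S φ)
  smul_mem' := by
    rintro a _ ⟨x, hx, rfl⟩
    exact ⟨a ⊗ₜ 1 * x, I.mul_mem_left _ hx, slice_tmul_one_mul φ a x⟩

instance sliceIdeal.isTwoSided {T : Type*} [Ring T] [Algebra F T] (φ : T →ₗ[F] F)
    (I : Ideal (S ⊗[F] T)) [I.IsTwoSided] : (sliceIdeal φ I).IsTwoSided :=
  ⟨by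
    rintro _ b ⟨x, hx, rfl⟩
    exact ⟨x * b ⊗ₜ 1, I.mul_mem_right _ hx, slice_mul_tmul_one φ x b⟩⟩

end SelfCentralizing

section SemisimpleTensor

open Algebra.FormallyUnramified

variable {F : Type*} [Field F]
  {K : Type*} [CommRing K] [Algebra F K] [Algebra.FormallyUnramified F K]
  [Algebra.EssFiniteType F K] {S : Type*} [Ring S] [Algebra F S] [IsSemisimpleRing S]
  {ι : K →ₐ[F] S}

/-- Some coefficient ideal of a nonzero `I` contains a nonzero central element; averaging over `K`
fixes it and moves all other coefficients into `K`. -/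
theorem eq_bot_of_comap_map_id_eq_bot (hι : Function.Injective ι) (hC : IsSelfCentralizing ι)
    {T : Type*} [Ring T] [Algebra F T] {I : Ideal (S ⊗[F] T)} [I.IsTwoSided]
    (hI : I.comap (Algebra.TensorProduct.map ι (AlgHom.id F T)) = ⊥) : I = ⊥ := by
  by_contra hne
  obtain ⟨x, hx, hx0⟩ := I.ne_bot_iff.1 hne
  obtain ⟨φ, hφ⟩ := exists_slice_ne_zero hx0
  have hcoeff : sliceIdeal φ I ≠ ⊥ := (Submodule.ne_bot_iff _).2 ⟨_, ⟨x, hx, rfl⟩, hφ⟩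
  obtain ⟨_, ⟨f, hf, rfl⟩, hf0, hcentral⟩ := exists_central_mem_of_ne_bot hcoeff
  let y := bimulHom (Algebra.TensorProduct.includeLeft.comp ι) (elem F K) f
  have hyI : y ∈ I := bimulHom_apply_mem _ I _ hf
  obtain ⟨z, hz⟩ := mem_range_rTensor_of_slice (f := ι.toLinearMap) hι (x := y) fun ψ => by
    rw [slice_bimulHom]
    exact hC.bimulHom_elem_mem_range _
  have hz0 : z ∈ I.comap (Algebra.TensorProduct.map ι (AlgHom.id F T)) := by
    change ι.toLinearMap.rTensor T z ∈ I
    rwa [hz]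
  have hy0 : y = 0 := by
    rw [hI, Submodule.mem_bot] at hz0
    rw [← hz, hz0, map_zero]
  have hfix : slice S φ y = slice S φ f := by
    rw [slice_bimulHom]
    exact elem_apply_of_mem_bimoduleInvariants
      (mem_bimoduleInvariants_bimulHom_iff.2 fun k => (hcentral _).symm)
  exact hf0 (by rw [← hfix, hy0, map_zero])

variable {K' : Type*} [CommRing K'] [Algebra F K'] [Algebra.FormallyUnramified F K']
  [Algebra.EssFiniteType F K'] {S' : Type*} [Ring S'] [Algebra F S'] [IsSemisimpleRing S']
  {ι' : K' →ₐ[F] S'}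

theorem eq_bot_of_forall_isNilpotent (hι : Function.Injective ι) (hC : IsSelfCentralizing ι)
    (hι' : Function.Injective ι') (hC' : IsSelfCentralizing ι') {I : Ideal (S ⊗[F] S')}
    [I.IsTwoSided] (hI : ∀ x ∈ I, IsNilpotent x) : I = ⊥ := by
  let f : K ⊗[F] S' →ₐ[F] S ⊗[F] S' := Algebra.TensorProduct.map ι (AlgHom.id F S')
  let f' : K' ⊗[F] K →ₐ[F] S' ⊗[F] K := Algebra.TensorProduct.map ι' (AlgHom.id F K)
  let c : S' ⊗[F] K ≃ₐ[F] K ⊗[F] S' := Algebra.TensorProduct.comm F S' K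
  have hinj : Function.Injective (f.comp (c.toAlgHom.comp f')) :=
    (Module.Flat.rTensor_preserves_injective_linearMap ι.toLinearMap hι).comp
      (c.injective.comp (Module.Flat.rTensor_preserves_injective_linearMap ι'.toLinearMap hι'))
  have : Algebra.FormallyUnramified F (K' ⊗[F] K) := .comp F K' _
  have : Algebra.EssFiniteType F (K' ⊗[F] K) := .comp F K' _
  have : IsReduced (K' ⊗[F] K) := isReduced_of_field F _
  have hS' : (I.comap f).comap c = ⊥ := eq_bot_of_comap_map_id_eq_bot hι' hC' <|
    (Submodule.eq_bot_iff _).2 fun z hz => ((IsNilpotent.map_iff hinj).1 (hI _ hz)).eq_zero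
  refine eq_bot_of_comap_map_id_eq_bot hι hC ((Submodule.eq_bot_iff _).2 fun z hz => ?_)
  have hmem : c.symm z ∈ (I.comap f).comap c := by
    rwa [Ideal.mem_comap, c.apply_symm_apply]
  rwa [hS', Submodule.mem_bot, map_eq_zero_iff _ c.symm.injective] at hmem

theorem isSemisimpleRing_tensorProduct [FiniteDimensional F S] [FiniteDimensional F S']
    (hι : Function.Injective ι) (hC : IsSelfCentralizing ι)
    (hι' : Function.Injective ι') (hC' : IsSelfCentralizing ι') :
    IsSemisimpleRing (S ⊗[F] S') := by
  have : IsArtinianRing (S ⊗[F] S') := IsArtinianRing.of_finite F _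
  obtain ⟨n, hn⟩ := IsSemiprimaryRing.isNilpotent (R := S ⊗[F] S')
  refine IsArtinianRing.isSemisimpleRing_iff_jacobson.2
    (eq_bot_of_forall_isNilpotent hι hC hι' hC' fun x hx => ⟨n, ?_⟩)
  simpa [hn] using Ideal.pow_mem_pow hx n

theorem isSeparableAlgebra_of_isSelfCentralizing [FiniteDimensional F S]
    (hι : Function.Injective ι) (hC : IsSelfCentralizing ι) : IsSeparableAlgebra F S := by
  have : IsSemisimpleRing (S ⊗[F] Sᵐᵒᵖ) := isSemisimpleRing_tensorProduct hι hC
    (fun _ _ h => hι (MulOpposite.op_injective h)) hC.op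
  let : Module (S ⊗[F] Sᵐᵒᵖ) S := instModuleTensorProductMop F S
  exact Module.projective_of_isSemisimpleRing (S ⊗[F] Sᵐᵒᵖ) S

end SemisimpleTensor

section SeparabilityElement

variable {F R R' : Type*} [CommRing F] [Ring R] [Algebra F R] [Ring R'] [Algebra F R']

/-- A separability element `∑ aᵢ ⊗ bᵢ` of an associative algebra `R`: the image of `1` under a
section of the bimodule map `R ⊗ Rᵐᵒᵖ → R`. -/
structure IsSeparabilityElement (E : R ⊗[F] Rᵐᵒᵖ) : Prop where
  mulLeftRight_apply_one : AlgHom.mulLeftRight F R E 1 = 1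
  tmul_one_mul (a : R) : (a ⊗ₜ 1) * E = (1 ⊗ₜ MulOpposite.op a) * E

namespace IsSeparabilityElement

theorem mulLeftRight_tmul_one_mul {E : R ⊗[F] Rᵐᵒᵖ} (hE : IsSeparabilityElement E)
    (z : R ⊗[F] Rᵐᵒᵖ) (r : R) :
    (AlgHom.mulLeftRight F R z r ⊗ₜ 1) * E = z * ((r ⊗ₜ 1) * E) := by
  induction z with
  | zero => simp
  | add x y hx hy => rw [map_add, LinearMap.add_apply, TensorProduct.add_tmul, add_mul, add_mul,
      hx, hy]
  | tmul a b =>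
    calc (AlgHom.mulLeftRight F R (a ⊗ₜ b) r ⊗ₜ 1) * E
      _ = ((a * r) ⊗ₜ 1) * ((b.unop ⊗ₜ 1) * E) := by
        rw [AlgHom.mulLeftRight_apply, ← mul_assoc, Algebra.TensorProduct.tmul_mul_tmul, one_mul]
      _ = ((a * r) ⊗ₜ 1) * ((1 ⊗ₜ b) * E) := by
        rw [hE.tmul_one_mul, MulOpposite.op_unop]
      _ = a ⊗ₜ b * ((r ⊗ₜ 1) * E) := by simp [← mul_assoc]

theorem one : IsSeparabilityElement (1 : F ⊗[F] Fᵐᵒᵖ) where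
  mulLeftRight_apply_one := by simp
  tmul_one_mul a := by
    rw [mul_one, mul_one, ← mul_one a, ← smul_eq_mul, TensorProduct.smul_tmul,
      MulOpposite.op_smul, MulOpposite.op_one]

theorem map {f : R →ₐ[F] R'} (hf : Function.Surjective f) {E : R ⊗[F] Rᵐᵒᵖ}
    (hE : IsSeparabilityElement E) :
    IsSeparabilityElement (Algebra.TensorProduct.map f f.op E) where
  mulLeftRight_apply_one := by
    have map_mulLeftRight (z : R ⊗[F] Rᵐᵒᵖ) : AlgHom.mulLeftRight F R'
        (Algebra.TensorProduct.map f f.op z) 1 = f (AlgHom.mulLeftRight F R z 1) := by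
      induction z with
      | zero => simp
      | add x y hx hy => simp [hx, hy]
      | tmul a b => simp
    rw [map_mulLeftRight, hE.mulLeftRight_apply_one, map_one]
  tmul_one_mul a' := by
    obtain ⟨a, rfl⟩ := hf a'
    simpa using congrArg (Algebra.TensorProduct.map f f.op) (hE.tmul_one_mul a)

variable (F R R') in
/-- The rearrangement of factors from the tensor product of the enveloping algebras of `R` and `R'`
to the enveloping algebra of `R ⊗ R'`. -/
noncomputable def envelopingTensorHom :
    (R ⊗[F] Rᵐᵒᵖ) ⊗[F] (R' ⊗[F] R'ᵐᵒᵖ) →ₐ[F] (R ⊗[F] R') ⊗[F] (R ⊗[F] R')ᵐᵒᵖ :=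
  (Algebra.TensorProduct.map (AlgHom.id F _)
    (Algebra.TensorProduct.opAlgEquiv F F R R').toAlgHom).comp
    (Algebra.TensorProduct.tensorTensorTensorComm F F F F R Rᵐᵒᵖ R' R'ᵐᵒᵖ).toAlgHom

theorem envelopingTensorHom_tmul (a : R) (b : Rᵐᵒᵖ) (a' : R') (b' : R'ᵐᵒᵖ) :
    envelopingTensorHom F R R' ((a ⊗ₜ b) ⊗ₜ (a' ⊗ₜ b')) =
      (a ⊗ₜ a') ⊗ₜ MulOpposite.op (b.unop ⊗ₜ b'.unop) := by
  simp [envelopingTensorHom]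

theorem mulLeftRight_envelopingTensorHom (z : R ⊗[F] Rᵐᵒᵖ) (z' : R' ⊗[F] R'ᵐᵒᵖ) :
    AlgHom.mulLeftRight F (R ⊗[F] R') (envelopingTensorHom F R R' (z ⊗ₜ z')) 1 =
      AlgHom.mulLeftRight F R z 1 ⊗ₜ AlgHom.mulLeftRight F R' z' 1 := by
  induction z with
  | zero => simp
  | add x y hx hy => simp [TensorProduct.add_tmul, hx, hy]
  | tmul a b =>
    induction z' with
    | zero => simp
    | add x y hx hy => simp [TensorProduct.tmul_add, hx, hy]
    | tmul a' b' => simp [envelopingTensorHom_tmul, Algebra.TensorProduct.one_def]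

theorem tmul {E : R ⊗[F] Rᵐᵒᵖ} (hE : IsSeparabilityElement E) {E' : R' ⊗[F] R'ᵐᵒᵖ}
    (hE' : IsSeparabilityElement E') :
    IsSeparabilityElement (envelopingTensorHom F R R' (E ⊗ₜ E')) where
  mulLeftRight_apply_one := by
    rw [mulLeftRight_envelopingTensorHom, hE.mulLeftRight_apply_one, hE'.mulLeftRight_apply_one,
      Algebra.TensorProduct.one_def]
  tmul_one_mul x := by
    induction x with
    | zero => simp
    | add x y hx hy =>
      rw [TensorProduct.add_tmul, MulOpposite.op_add, TensorProduct.tmul_add, add_mul, add_mul,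
        hx, hy]
    | tmul a a' =>
      have left_eq : (a ⊗ₜ[F] a') ⊗ₜ[F] (1 : (R ⊗[F] R')ᵐᵒᵖ) =
          envelopingTensorHom F R R' ((a ⊗ₜ 1) ⊗ₜ (a' ⊗ₜ 1)) := by
        rw [envelopingTensorHom_tmul]; rfl
      have right_eq : (1 : R ⊗[F] R') ⊗ₜ[F] MulOpposite.op (a ⊗ₜ[F] a') =
          envelopingTensorHom F R R' ((1 ⊗ₜ MulOpposite.op a) ⊗ₜ (1 ⊗ₜ MulOpposite.op a')) := by
        rw [envelopingTensorHom_tmul]; rfl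
      rw [left_eq, right_eq, ← map_mul, ← map_mul, Algebra.TensorProduct.tmul_mul_tmul,
        Algebra.TensorProduct.tmul_mul_tmul, hE.tmul_one_mul, hE'.tmul_one_mul]

end IsSeparabilityElement

end SeparabilityElement

section SeparableAlgebra

theorem isSeparableAlgebra_iff_exists_isSeparabilityElement {F : Type u} [Field F] {R : Type v}
    [Ring R] [Algebra F R] :
    IsSeparableAlgebra F R ↔ ∃ E : R ⊗[F] Rᵐᵒᵖ, IsSeparabilityElement E := by
  let : Module (R ⊗[F] Rᵐᵒᵖ) R := instModuleTensorProductMop F R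
  have smul_def (z : R ⊗[F] Rᵐᵒᵖ) (x : R) : z • x = AlgHom.mulLeftRight F R z x := rfl
  constructor
  · intro (h : Module.Projective (R ⊗[F] Rᵐᵒᵖ) R)
    obtain ⟨s, hs⟩ := Module.projective_lifting_property
      (LinearMap.toSpanSingleton (R ⊗[F] Rᵐᵒᵖ) R 1) LinearMap.id fun r =>
        ⟨r ⊗ₜ 1, by simp [smul_def]⟩
    refine ⟨s 1, LinearMap.congr_fun hs 1, fun a => ?_⟩
    rw [← smul_eq_mul, ← smul_eq_mul, ← map_smul, ← map_smul]
    congr 1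
    simp [smul_def]
  · rintro ⟨E, hE⟩
    let s : R →ₗ[R ⊗[F] Rᵐᵒᵖ] R ⊗[F] Rᵐᵒᵖ :=
      { toFun r := (r ⊗ₜ 1) * E
        map_add' x y := by rw [TensorProduct.add_tmul, add_mul]
        map_smul' := hE.mulLeftRight_tmul_one_mul }
    refine Module.Projective.of_split s (LinearMap.toSpanSingleton (R ⊗[F] Rᵐᵒᵖ) R 1)
      (LinearMap.ext fun r => ?_)
    change AlgHom.mulLeftRight F R ((r ⊗ₜ 1) * E) 1 = r
    rw [map_mul, Module.End.mul_apply, hE.mulLeftRight_apply_one]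
    simp

variable {F R R' : Type*} [Field F] [Ring R] [Algebra F R] [Ring R'] [Algebra F R']

variable (F) in
theorem isSeparableAlgebra_self : IsSeparableAlgebra F F :=
  isSeparableAlgebra_iff_exists_isSeparabilityElement.2 ⟨1, .one⟩

theorem IsSeparableAlgebra.of_surjective {f : R →ₐ[F] R'} (hf : Function.Surjective f)
    (h : IsSeparableAlgebra F R) : IsSeparableAlgebra F R' := by
  obtain ⟨E, hE⟩ := isSeparableAlgebra_iff_exists_isSeparabilityElement.1 h
  exact isSeparableAlgebra_iff_exists_isSeparabilityElement.2 ⟨_, hE.map hf⟩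

theorem IsSeparableAlgebra.tensorProduct (h : IsSeparableAlgebra F R)
    (h' : IsSeparableAlgebra F R') : IsSeparableAlgebra F (R ⊗[F] R') := by
  obtain ⟨E, hE⟩ := isSeparableAlgebra_iff_exists_isSeparabilityElement.1 h
  obtain ⟨E', hE'⟩ := isSeparableAlgebra_iff_exists_isSeparabilityElement.1 h'
  exact isSeparableAlgebra_iff_exists_isSeparabilityElement.2 ⟨_, hE.tmul hE'⟩

end SeparableAlgebra

section Nucleus

variable {F A B : Type*} [Field F]
  [NonAssocRing A] [Module F A] [SMulCommClass F A A] [IsScalarTower F A A]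
  [NonAssocRing B] [Module F B] [SMulCommClass F B B] [IsScalarTower F B B]

namespace nucleus

theorem coe_one : ((1 : nucleus F A) : A) = 1 := rfl

theorem coe_mul (x y : nucleus F A) : ((x * y : nucleus F A) : A) = x * y := rfl

theorem coe_algebraMap (c : F) : (algebraMap F (nucleus F A) c : A) = c • 1 := by
  rw [Algebra.algebraMap_eq_smul_one]
  rfl

instance nontrivial [Nontrivial A] : Nontrivial (nucleus F A) :=
  ⟨0, 1, fun h => zero_ne_one (congrArg Subtype.val h)⟩

end nucleus

theorem mem_center_iff_mem_nucleus {x : A} :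
    x ∈ Set.center A ↔ x ∈ nucleus F A ∧ ∀ a, Commute x a := by
  rw [Set.mem_center_iff, isMulCentral_iff, mem_nucleus_iff]
  constructor
  · rintro ⟨h1, h2, h3⟩
    refine ⟨⟨fun a b => (h2 a b).symm, fun a b => ?_, h3⟩, h1⟩
    rw [← (h1 a).eq, ← h2, (h1 _).eq, h3, (h1 b).eq]
  · rintro ⟨⟨h1, _, h3⟩, h⟩
    exact ⟨h, fun a b => (h1 a b).symm, h3⟩

theorem smul_one_mem_center (c : F) : c • (1 : A) ∈ Set.center A :=
  mem_center_iff_mem_nucleus.2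
    ⟨(nucleus F A).smul_mem c (one_mem_nucleus F A), fun a => (Commute.one_left a).smul_left c⟩

theorem map_mem_nucleus (e : A ≃ₗ[F] B) (he : ∀ x y, e (x * y) = e x * e y) {x : A}
    (hx : x ∈ nucleus F A) : e x ∈ nucleus F B := by
  rw [mem_nucleus_iff] at *
  obtain ⟨h1, h2, h3⟩ := hx
  refine ⟨fun a b => ?_, fun a b => ?_, fun a b => ?_⟩ <;>
  · obtain ⟨a, rfl⟩ := e.surjective a
    obtain ⟨b, rfl⟩ := e.surjective b
    simp only [← he, h1, h2, h3]

/-- The restriction of an isomorphism of nonassociative algebras to the nuclei. -/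
noncomputable def nucleusCongr (e : A ≃ₗ[F] B) (he : ∀ x y, e (x * y) = e x * e y) :
    nucleus F A ≃ₐ[F] nucleus F B :=
  AlgEquiv.ofLinearEquiv
    (e.ofSubmodules _ _ (le_antisymm
      (Submodule.map_le_iff_le_comap.2 fun _ hx => map_mem_nucleus e he hx)
      fun x hx => ⟨e.symm x,
        map_mem_nucleus e.symm (fun x y => e.injective (by simp [he])) hx,
        e.apply_symm_apply x⟩))
    (Subtype.ext (map_one (MulEquiv.mk e.toEquiv he))) (fun x y => Subtype.ext (he x.1 y.1))

theorem slice_mem_nucleus (φ : B →ₗ[F] F) {x : A ⊗[F] B} (hx : x ∈ nucleus F (A ⊗[F] B)) :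
    slice A φ x ∈ nucleus F A := by
  rw [mem_nucleus_iff] at *
  obtain ⟨h1, h2, h3⟩ := hx
  have mul_tmul_one (a b : A) : (a * b) ⊗ₜ[F] (1 : B) = a ⊗ₜ 1 * b ⊗ₜ 1 := by simp
  refine ⟨fun a b => ?_, fun a b => ?_, fun a b => ?_⟩
  · simp only [← slice_mul_tmul_one, h1, mul_tmul_one]
  · simp only [← slice_mul_tmul_one, ← slice_tmul_one_mul, h2]
  · simp only [← slice_tmul_one_mul, ← h3, mul_tmul_one]

theorem tmul_mem_nucleus {a : A} {b : B} (ha : a ∈ nucleus F A) (hb : b ∈ nucleus F B) :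
    a ⊗ₜ b ∈ nucleus F (A ⊗[F] B) := by
  rw [mem_nucleus_iff] at *
  obtain ⟨ha1, ha2, ha3⟩ := ha
  obtain ⟨hb1, hb2, hb3⟩ := hb
  refine ⟨fun x y => ?_, fun x y => ?_, fun x y => ?_⟩ <;>
  · induction x with
    | zero => simp
    | add x x' hx hx' => simp only [mul_add, add_mul, hx, hx']
    | tmul a' b' =>
      induction y with
      | zero => simp
      | add y y' hy hy' => simp only [mul_add, add_mul, hy, hy']
      | tmul a'' b'' => simp only [Algebra.TensorProduct.tmul_mul_tmul, *]

variable (F A B) in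
theorem nucleus_tensorProduct : nucleus F (A ⊗[F] B) =
    LinearMap.range (TensorProduct.mapIncl (nucleus F A) (nucleus F B)) := by
  refine le_antisymm (fun x hx => mem_range_mapIncl_of_slice (fun φ => slice_mem_nucleus φ hx)
    fun φ => slice_mem_nucleus φ (map_mem_nucleus _ tensorProduct_comm_mul hx)) ?_
  rw [TensorProduct.range_mapIncl, Submodule.map₂_le]
  exact fun a ha b hb => tmul_mem_nucleus ha hb

variable (F A B) in
/-- The identification of the tensor product of the nuclei with the nucleus of the tensor
product. -/
noncomputable def nucleusTensorEquiv :
    nucleus F A ⊗[F] nucleus F B ≃ₐ[F] nucleus F (A ⊗[F] B) :=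
  Algebra.TensorProduct.algEquivOfLinearEquivTensorProduct
    ((LinearEquiv.ofInjective (TensorProduct.mapIncl (nucleus F A) (nucleus F B))
      (TensorProduct.map_injective_of_flat_flat _ _ (nucleus F A).injective_subtype
        (nucleus F B).injective_subtype)).trans
      (LinearEquiv.ofEq _ _ (nucleus_tensorProduct F A B).symm))
    (fun a a' b b' => Subtype.ext (Algebra.TensorProduct.tmul_mul_tmul a.1 a'.1 b.1 b'.1).symm) rfl

theorem coe_nucleusTensorEquiv (x : nucleus F A ⊗[F] nucleus F B) :
    (nucleusTensorEquiv F A B x : A ⊗[F] B) =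
      TensorProduct.mapIncl (nucleus F A) (nucleus F B) x := rfl

end Nucleus

theorem isSemisimpleRing_of_etale (F K : Type*) [Field F] [CommRing K] [Algebra F K]
    [Algebra.Etale F K] : IsSemisimpleRing K := by
  have : FiniteDimensional F K := Algebra.FormallyUnramified.finite_of_free F K
  have : IsArtinianRing K := IsArtinianRing.of_finite F _
  have : IsReduced K := Algebra.FormallyUnramified.isReduced_of_field F _
  exact IsArtinianRing.isSemisimpleRing_of_isReduced K

theorem etale_tensorProduct (F K K' : Type*) [CommRing F] [CommRing K] [Algebra F K]
    [CommRing K'] [Algebra F K'] [Algebra.Etale F K] [Algebra.Etale F K'] :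
    Algebra.Etale F (K ⊗[F] K') :=
  .comp F K _

theorem mem_range_algebraMap_of_tmul_one_eq_one_tmul {F K : Type*} [Field F] [Ring K]
    [Nontrivial K] [Algebra F K] {k : K} (hk : k ⊗ₜ[F] (1 : K) = 1 ⊗ₜ k) :
    k ∈ Set.range (algebraMap F K) := by
  obtain ⟨φ, hφ⟩ := (Algebra.linearMap F K).exists_leftInverse_of_injective
    (LinearMap.ker_eq_bot.2 (algebraMap F K).injective)
  have hφ1 : φ 1 = 1 := by simpa using LinearMap.congr_fun hφ 1
  refine ⟨φ k, ?_⟩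
  simpa [hφ1, Algebra.algebraMap_eq_smul_one] using (congrArg (slice K φ) hk).symm

section BimoduleGenerator

open scoped IsMulCommutative

variable {F A B K K' : Type*} [Field F]
  [NonAssocRing A] [Module F A] [SMulCommClass F A A] [IsScalarTower F A A]
  [NonAssocRing B] [Module F B] [SMulCommClass F B B] [IsScalarTower F B B]
  [CommRing K] [Algebra F K] [CommRing K'] [Algebra F K']

instance isMulCommutative_range (ι : K →ₐ[F] nucleus F A) : IsMulCommutative ι.range :=
  .of_setLike_mul_comm <| by
    rintro _ ⟨x, rfl⟩ _ ⟨y, rfl⟩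
    exact (Commute.all x y).map ι

/-- The action of `K ⊗ K` on `A` by `(k ⊗ k') • a = ι k * a * ι k'`, for an algebra `K` mapping to
the nucleus of `A`. -/
noncomputable def nucleusBiMulHom (ι : K →ₐ[F] nucleus F A) : K ⊗[F] K →ₐ[F] Module.End F A :=
  (nucleusBiMul ι.range).comp (Algebra.TensorProduct.map ι.rangeRestrict ι.rangeRestrict)

theorem nucleusBiMulHom_tmul (ι : K →ₐ[F] nucleus F A) (k k' : K) (a : A) :
    nucleusBiMulHom ι (k ⊗ₜ k') a = (ι k : A) * a * (ι k' : A) :=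
  nucleusBiMul_tmul ι.range _ _ a

theorem nucleusBiMulHom_mul_apply (ι : K →ₐ[F] nucleus F A) (z z' : K ⊗[F] K) (x : A) :
    nucleusBiMulHom ι (z * z') x = nucleusBiMulHom ι z (nucleusBiMulHom ι z' x) := by
  rw [map_mul, Module.End.mul_apply]

theorem nucleusBiMulHom_val (K : Subalgebra F (nucleus F A)) [IsMulCommutative K] :
    nucleusBiMulHom K.val = nucleusBiMul K :=
  Algebra.TensorProduct.ext' fun k k' => LinearMap.ext fun a => by
    rw [nucleusBiMulHom_tmul, nucleusBiMul_tmul]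
    rfl

theorem coe_mem_bimoduleInvariants_nucleusBiMulHom_iff {ι : K →ₐ[F] nucleus F A}
    {r : nucleus F A} :
    (r : A) ∈ bimoduleInvariants (nucleusBiMulHom ι) ↔ ∀ k, Commute (ι k) r := by
  simp [mem_bimoduleInvariants_iff, nucleusBiMulHom_tmul, nucleus.coe_one, Commute, SemiconjBy,
    Subtype.ext_iff, nucleus.coe_mul]

/-- The element `a` freely generates `A` as a `K`-bimodule: `z ↦ z • a` is a bijection from
`K ⊗ K` onto `A`, where `K` acts through the nucleus. -/
def IsBimoduleGenerator (ι : K →ₐ[F] nucleus F A) (a : A) : Prop :=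
  Function.Bijective fun z => nucleusBiMulHom ι z a

namespace IsBimoduleGenerator

open Algebra (FormallyUnramified EssFiniteType)
open Algebra.FormallyUnramified (elem)

variable {ι : K →ₐ[F] nucleus F A} {a : A}

theorem injective (ha : IsBimoduleGenerator ι a) : Function.Injective ι := by
  rw [injective_iff_map_eq_zero]
  intro k hk
  have tmul_one_eq_zero : k ⊗ₜ[F] (1 : K) = 0 :=
    ha.1 (by simp [nucleusBiMulHom_tmul, hk])
  simpa using congrArg (Algebra.TensorProduct.lmul' F) tmul_one_eq_zero

theorem exists_apply_elem_apply_eq [FormallyUnramified F K] [EssFiniteType F K]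
    (ha : IsBimoduleGenerator ι a) {x : A} (hx : x ∈ bimoduleInvariants (nucleusBiMulHom ι)) :
    ∃ k : K, nucleusBiMulHom ι (k ⊗ₜ 1) (nucleusBiMulHom ι (elem F K) a) = x := by
  obtain ⟨z, rfl⟩ := ha.2 x
  refine ⟨Algebra.TensorProduct.lmul' F z, ?_⟩
  rw [← apply_of_mem_bimoduleInvariants (elem_apply_mem_bimoduleInvariants _ a),
    ← nucleusBiMulHom_mul_apply, mul_comm, nucleusBiMulHom_mul_apply]
  exact elem_apply_of_mem_bimoduleInvariants hx

/-- Since `1` is invariant, `1 = ι k₀ * c` for the generator `c` of the invariants; then `k₀` is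
not a zero divisor, hence a unit, and every invariant `ι k * c` lies in `K`. -/
theorem isSelfCentralizing [FormallyUnramified F K] [EssFiniteType F K]
    (ha : IsBimoduleGenerator ι a) : IsSelfCentralizing ι := by
  intro r hr
  have := Algebra.FormallyUnramified.finite_of_free F K
  obtain ⟨k₀, hk₀⟩ := ha.exists_apply_elem_apply_eq
    (coe_mem_bimoduleInvariants_nucleusBiMulHom_iff.2 fun k => Commute.one_right (ι k))
  obtain ⟨k, hk⟩ := ha.exists_apply_elem_apply_eq
    (coe_mem_bimoduleInvariants_nucleusBiMulHom_iff.2 hr)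
  set c := nucleusBiMulHom ι (elem F K) a
  have coe_ι (k : K) : (ι k : A) = nucleusBiMulHom ι ((k * k₀) ⊗ₜ 1) c := by
    have tmul_eq : (k * k₀) ⊗ₜ[F] (1 : K) = (k ⊗ₜ 1) * (k₀ ⊗ₜ 1) := by simp
    rw [tmul_eq, nucleusBiMulHom_mul_apply, hk₀, nucleusBiMulHom_tmul]
    simp [nucleus.coe_one]
  have mul_k₀_injective : Function.Injective (LinearMap.mulRight F k₀) := by
    rw [injective_iff_map_eq_zero]
    intro k' (hk' : k' * k₀ = 0)
    exact (map_eq_zero_iff ι ha.injective).1 (Subtype.ext (by simp [coe_ι, hk']))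
  obtain ⟨k', hk' : k' * k₀ = k⟩ := LinearMap.injective_iff_surjective.1 mul_k₀_injective k
  exact ⟨k', Subtype.ext (by rw [← hk, ← hk']; exact coe_ι k')⟩

theorem center_eq [Nontrivial A] [FormallyUnramified F K] [EssFiniteType F K]
    (ha : IsBimoduleGenerator ι a) : Set.center A = Set.range fun c : F => c • (1 : A) := by
  refine (Set.range_subset_iff.2 smul_one_mem_center).antisymm' fun x hx => ?_
  obtain ⟨hx, hcomm⟩ := mem_center_iff_mem_nucleus (F := F).1 hx
  obtain ⟨k, hk⟩ := ha.isSelfCentralizing ⟨x, hx⟩ fun k => Subtype.ext (hcomm (ι k)).eq.symm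
  obtain rfl : (ι k : A) = x := congrArg Subtype.val hk
  have : Nontrivial K := ι.toRingHom.domain_nontrivial
  obtain ⟨c, rfl⟩ := mem_range_algebraMap_of_tmul_one_eq_one_tmul (F := F) (k := k) <|
    ha.1 (by simpa [nucleusBiMulHom_tmul, nucleus.coe_one] using (hcomm a).eq)
  exact ⟨c, by rw [AlgHom.commutes, nucleus.coe_algebraMap]⟩

theorem finiteDimensional [FormallyUnramified F K] [EssFiniteType F K]
    (ha : IsBimoduleGenerator ι a) : FiniteDimensional F A := by
  have := Algebra.FormallyUnramified.finite_of_free F K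
  exact Module.Finite.of_surjective ((nucleusBiMulHom ι).toLinearMap.flip a) ha.2

theorem isSemiassociative [Nontrivial A] [Algebra.Etale F K] (ha : IsBimoduleGenerator ι a) :
    IsSemiassociative F A := by
  have : Algebra.Etale F ι.range := .of_equiv (AlgEquiv.ofInjective ι ha.injective)
  have : Algebra.Etale F (ι.range ⊗[F] ι.range) := etale_tensorProduct F _ _
  have := isSemisimpleRing_of_etale F (ι.range ⊗[F] ι.range)
  refine ⟨inferInstance, ha.finiteDimensional, ha.center_eq, ι.range, inferInstance,
    inferInstance, ?_⟩
  let : Module (ι.range ⊗[F] ι.range) A := nucleusBimodule ι.range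
  refine isMinimallyFaithful_of_smul_bijective (m := a) ⟨Function.Injective.of_comp_right ha.1 ?_,
    Function.Surjective.of_comp ha.2⟩
  exact TensorProduct.map_surjective ι.rangeRestrict_surjective ι.rangeRestrict_surjective

theorem map (ha : IsBimoduleGenerator ι a) (e : A ≃ₗ[F] B) (he : ∀ x y, e (x * y) = e x * e y) :
    IsBimoduleGenerator ((nucleusCongr e he).toAlgHom.comp ι) (e a) := by
  have apply_eq : (fun z => nucleusBiMulHom ((nucleusCongr e he).toAlgHom.comp ι) z (e a)) =
      e ∘ fun z => nucleusBiMulHom ι z a := by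
    funext z
    induction z with
    | zero => simp
    | add x y hx hy => simp_all
    | tmul k k' =>
      simp only [Function.comp_apply, nucleusBiMulHom_tmul, he]
      rfl
  rw [IsBimoduleGenerator, apply_eq]
  exact e.bijective.comp ha

end IsBimoduleGenerator

theorem nucleusBiMulHom_nucleusTensorEquiv_comp_map (ι : K →ₐ[F] nucleus F A)
    (ι' : K' →ₐ[F] nucleus F B) (z : K ⊗[F] K) (z' : K' ⊗[F] K') (a : A) (b : B) :
    nucleusBiMulHom ((nucleusTensorEquiv F A B).toAlgHom.comp (Algebra.TensorProduct.map ι ι'))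
        (TensorProduct.tensorTensorTensorComm F K K K' K' (z ⊗ₜ z')) (a ⊗ₜ b) =
      nucleusBiMulHom ι z a ⊗ₜ nucleusBiMulHom ι' z' b := by
  induction z with
  | zero => simp
  | add x y hx hy =>
    simp only [TensorProduct.add_tmul, map_add, LinearMap.add_apply, hx, hy]
  | tmul k l =>
    induction z' with
    | zero => simp
    | add x y hx hy =>
      simp only [TensorProduct.tmul_add, map_add, LinearMap.add_apply, hx, hy]
    | tmul k' l' =>
      simp [nucleusBiMulHom_tmul, coe_nucleusTensorEquiv, TensorProduct.mapIncl]

theorem IsBimoduleGenerator.tmul {ι : K →ₐ[F] nucleus F A} {a : A}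
    (ha : IsBimoduleGenerator ι a) {ι' : K' →ₐ[F] nucleus F B} {b : B}
    (hb : IsBimoduleGenerator ι' b) :
    IsBimoduleGenerator
      ((nucleusTensorEquiv F A B).toAlgHom.comp (Algebra.TensorProduct.map ι ι')) (a ⊗ₜ b) := by
  let f : K ⊗[F] K ≃ₗ[F] A :=
    LinearEquiv.ofBijective ((nucleusBiMulHom ι).toLinearMap.flip a) ha
  let f' : K' ⊗[F] K' ≃ₗ[F] B :=
    LinearEquiv.ofBijective ((nucleusBiMulHom ι').toLinearMap.flip b) hb
  let c := TensorProduct.tensorTensorTensorComm F K K K' K'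
  have comp_c_eq : (fun z => nucleusBiMulHom ((nucleusTensorEquiv F A B).toAlgHom.comp
      (Algebra.TensorProduct.map ι ι')) z (a ⊗ₜ b)) ∘ c = TensorProduct.congr f f' := by
    funext z
    induction z with
    | zero => simp
    | add x y hx hy => simp_all
    | tmul z z' => exact nucleusBiMulHom_nucleusTensorEquiv_comp_map ι ι' z z' a b
  rw [IsBimoduleGenerator, ← Function.Bijective.of_comp_iff _ c.bijective, comp_c_eq]
  exact (TensorProduct.congr f f').bijective

variable (F) in
theorem isBimoduleGenerator_ofId_one :
    IsBimoduleGenerator (Algebra.ofId F (nucleus F F)) (1 : F) := by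
  rw [IsBimoduleGenerator]
  convert (TensorProduct.lid F F).bijective with z
  induction z with
  | zero => simp
  | add x y hx hy => simp_all
  | tmul k k' => simp [nucleusBiMulHom_tmul, Algebra.ofId_apply, nucleus.coe_algebraMap]

end BimoduleGenerator

open scoped IsMulCommutative in
theorem IsSemiassociative.exists_isBimoduleGenerator {F : Type u} [Field F] {A : Type v}
    [NonAssocRing A] [Module F A] [SMulCommClass F A A] [IsScalarTower F A A]
    (hA : IsSemiassociative F A) :
    ∃ (K : Type v) (_ : CommRing K) (_ : Algebra F K) (_ : Algebra.Etale F K)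
      (ι : K →ₐ[F] nucleus F A) (a : A), IsBimoduleGenerator ι a := by
  obtain ⟨K, _, _, hmin⟩ := hA.exists_etale
  have : Algebra.Etale F (K ⊗[F] K) := etale_tensorProduct F K K
  have := isSemisimpleRing_of_etale F (K ⊗[F] K)
  let : Module (K ⊗[F] K) A := nucleusBimodule K
  obtain ⟨a, ha⟩ := hmin.exists_smul_bijective
  refine ⟨K, inferInstance, inferInstance, inferInstance, K.val, a, ?_⟩
  rwa [IsBimoduleGenerator, nucleusBiMulHom_val]

section JacobsonQuotient

variable {F R R' : Type*} [CommRing F] [Ring R] [Algebra F R] [Ring R'] [Algebra F R']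

theorem ringEquiv_apply_mem_jacobson_iff {R R' : Type*} [Ring R] [Ring R'] (e : R ≃+* R') {x : R} :
    e x ∈ Ring.jacobson R' ↔ x ∈ Ring.jacobson R := by
  have : RingHomSurjective e.toRingHom := ⟨e.surjective⟩
  exact SetLike.ext_iff.1
    (Module.comap_jacobson_of_bijective (f := e.toRingHom.toSemilinearMap) e.bijective) x

theorem map_jacobson_of_ringEquiv {R R' : Type*} [Ring R] [Ring R'] (e : R ≃+* R') :
    (Ring.jacobson R).map (e : R →+* R') = Ring.jacobson R' := by
  ext y
  obtain ⟨x, rfl⟩ := e.surjective y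
  refine (Ideal.mem_map_of_equiv e _).trans ?_
  rw [ringEquiv_apply_mem_jacobson_iff]
  exact ⟨fun ⟨z, hz, hzx⟩ => e.injective hzx ▸ hz, fun hx => ⟨x, hx, rfl⟩⟩

/-- The isomorphism of the quotients by the Jacobson radicals induced by an isomorphism. -/
noncomputable def jacobsonQuotientCongr (e : R ≃ₐ[F] R') :
    (R ⧸ Ring.jacobson R) ≃ₐ[F] (R' ⧸ Ring.jacobson R') :=
  Ideal.quotientEquivAlg _ _ e (map_jacobson_of_ringEquiv e.toRingEquiv).symm

variable (F R R') in
/-- The quotient of `R ⊗ R'` by its Jacobson radical, when the tensor product of the quotients of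
`R` and `R'` is semisimple. -/
noncomputable def jacobsonQuotientTensorEquiv [IsSemiprimaryRing R] [IsSemiprimaryRing R']
    [IsSemisimpleRing ((R ⧸ Ring.jacobson R) ⊗[F] (R' ⧸ Ring.jacobson R'))] :
    (R ⊗[F] R' ⧸ Ring.jacobson (R ⊗[F] R')) ≃ₐ[F]
      (R ⧸ Ring.jacobson R) ⊗[F] (R' ⧸ Ring.jacobson R') :=
  (Ideal.quotientEquivAlgOfEq F (ker_tensorJacobsonProj (F := F)).symm).trans
    (Ideal.quotientKerAlgEquivOfSurjective tensorJacobsonProj_surjective)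

theorem injective_mkₐ_jacobson_comp [IsSemiprimaryRing R] {K : Type*} [CommRing K] [Algebra F K]
    [IsReduced K] {ι : K →ₐ[F] R} (hι : Function.Injective ι) :
    Function.Injective ((Ideal.Quotient.mkₐ F (Ring.jacobson R)).comp ι) := by
  obtain ⟨n, hn⟩ := IsSemiprimaryRing.isNilpotent (R := R)
  rw [injective_iff_map_eq_zero]
  intro k hk
  have hk : ι k ∈ Ring.jacobson R := Ideal.Quotient.eq_zero_iff_mem.1 hk
  refine IsNilpotent.eq_zero ((IsNilpotent.map_iff hι).1 ⟨n, ?_⟩)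
  simpa [hn] using Ideal.pow_mem_pow hk n

end JacobsonQuotient

section Semiassociative

variable {F : Type u} [Field F] {A : Type v} {B : Type w}
  [NonAssocRing A] [Module F A] [SMulCommClass F A A] [IsScalarTower F A A]
  [NonAssocRing B] [Module F B] [SMulCommClass F B B] [IsScalarTower F B B]

variable (F) in
theorem isSemiassociative_self : IsSemiassociative F F :=
  (isBimoduleGenerator_ofId_one F).isSemiassociative

variable (F A B) in
theorem radNucleus_tensorProduct_eq_map : radNucleus F (A ⊗[F] B) =
    ((Ring.jacobson (nucleus F A ⊗[F] nucleus F B)).restrictScalars F).map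
      (TensorProduct.mapIncl (nucleus F A) (nucleus F B)) := by
  ext x
  constructor
  · rintro ⟨y, hy, rfl⟩
    obtain ⟨z, rfl⟩ := (nucleusTensorEquiv F A B).surjective y
    exact ⟨z, (ringEquiv_apply_mem_jacobson_iff (nucleusTensorEquiv F A B).toRingEquiv).1 hy, rfl⟩
  · rintro ⟨z, hz, rfl⟩
    exact ⟨nucleusTensorEquiv F A B z,
      (ringEquiv_apply_mem_jacobson_iff (nucleusTensorEquiv F A B).toRingEquiv).2 hz, rfl⟩

namespace IsSemiassociative

theorem of_linearEquiv (hA : IsSemiassociative F A) (e : A ≃ₗ[F] B)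
    (he : ∀ x y, e (x * y) = e x * e y) : IsSemiassociative F B := by
  have := hA.nontrivial
  have := e.symm.toEquiv.nontrivial
  obtain ⟨K, _, _, _, ι, a, ha⟩ := hA.exists_isBimoduleGenerator
  exact (ha.map e he).isSemiassociative

theorem tensorProduct (hA : IsSemiassociative F A) (hB : IsSemiassociative F B) :
    IsSemiassociative F (A ⊗[F] B) := by
  have := hA.nontrivial
  have := hB.nontrivial
  obtain ⟨K, _, _, _, ι, a, ha⟩ := hA.exists_isBimoduleGenerator
  obtain ⟨K', _, _, _, ι', b, hb⟩ := hB.exists_isBimoduleGenerator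
  have := etale_tensorProduct F K K'
  exact (ha.tmul hb).isSemiassociative

theorem isArtinianRing_nucleus (hA : IsSemiassociative F A) : IsArtinianRing (nucleus F A) :=
  have := hA.finite
  IsArtinianRing.of_finite F _

theorem exists_isSelfCentralizing (hA : IsSemiassociative F A) :
    ∃ (K : Type v) (_ : CommRing K) (_ : Algebra F K) (_ : Algebra.Etale F K)
      (ι : K →ₐ[F] SemisimpleQuotient F A), Function.Injective ι ∧ IsSelfCentralizing ι := by
  have := hA.isArtinianRing_nucleus
  obtain ⟨K, _, _, _, ι, a, ha⟩ := hA.exists_isBimoduleGenerator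
  have : IsReduced K := Algebra.FormallyUnramified.isReduced_of_field F K
  exact ⟨K, inferInstance, inferInstance, inferInstance, _,
    injective_mkₐ_jacobson_comp ha.injective,
    ha.isSelfCentralizing.comp_of_surjective (Ideal.Quotient.mkₐ_surjective F _)⟩

theorem isSeparableAlgebra (hA : IsSemiassociative F A) :
    IsSeparableAlgebra F (SemisimpleQuotient F A) := by
  have := hA.finite
  have := hA.isArtinianRing_nucleus
  obtain ⟨K, _, _, _, ι, hι, hC⟩ := hA.exists_isSelfCentralizing
  exact isSeparableAlgebra_of_isSelfCentralizing hι hC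

theorem isSemisimpleRing_tensorProduct (hA : IsSemiassociative F A) (hB : IsSemiassociative F B) :
    IsSemisimpleRing (SemisimpleQuotient F A ⊗[F] SemisimpleQuotient F B) := by
  have := hA.finite
  have := hB.finite
  have := hA.isArtinianRing_nucleus
  have := hB.isArtinianRing_nucleus
  obtain ⟨K, _, _, _, ι, hι, hC⟩ := hA.exists_isSelfCentralizing
  obtain ⟨K', _, _, _, ι', hι', hC'⟩ := hB.exists_isSelfCentralizing
  exact _root_.isSemisimpleRing_tensorProduct hι hC hι' hC'

theorem radNucleus_tensorProduct (hA : IsSemiassociative F A) (hB : IsSemiassociative F B) :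
    radNucleus F (A ⊗[F] B) =
      Submodule.map₂ (TensorProduct.mk F A B) (radNucleus F A) (nucleus F B) ⊔
        Submodule.map₂ (TensorProduct.mk F A B) (nucleus F A) (radNucleus F B) := by
  have := hA.isArtinianRing_nucleus
  have := hB.isArtinianRing_nucleus
  have := hA.isSemisimpleRing_tensorProduct hB
  have map_map₂_mk (P : Submodule F (nucleus F A)) (Q : Submodule F (nucleus F B)) :
      (Submodule.map₂ (TensorProduct.mk F _ _) P Q).map
          (TensorProduct.mapIncl (nucleus F A) (nucleus F B)) =
        Submodule.map₂ (TensorProduct.mk F A B) (P.map (nucleus F A).subtype)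
          (Q.map (nucleus F B).subtype) := by
    rw [Submodule.map_map₂, Submodule.map₂_map_map]
    rfl
  rw [radNucleus_tensorProduct_eq_map, jacobson_tensorProduct, Submodule.map_sup, map_map₂_mk,
    map_map₂_mk, Submodule.map_subtype_top, Submodule.map_subtype_top]
  rfl

end IsSemiassociative

/-- The isomorphism of semisimple quotients induced by an isomorphism of nonassociative
algebras. -/
noncomputable def semisimpleQuotientCongr (e : A ≃ₗ[F] B) (he : ∀ x y, e (x * y) = e x * e y) :
    SemisimpleQuotient F A ≃ₐ[F] SemisimpleQuotient F B :=
  jacobsonQuotientCongr (nucleusCongr e he)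

theorem nonempty_semisimpleQuotient_tensorProduct_algEquiv
    (hA : IsSemiassociative F A) (hB : IsSemiassociative F B) :
    Nonempty (SemisimpleQuotient F (A ⊗[F] B) ≃ₐ[F]
      SemisimpleQuotient F A ⊗[F] SemisimpleQuotient F B) := by
  have := hA.isArtinianRing_nucleus
  have := hB.isArtinianRing_nucleus
  have := hA.isSemisimpleRing_tensorProduct hB
  exact ⟨(jacobsonQuotientCongr (nucleusTensorEquiv F A B).symm).trans
    (jacobsonQuotientTensorEquiv F (nucleus F A) (nucleus F B))⟩

variable (F) in
/-- The identification of `σ(F)` with `F`. -/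
noncomputable def semisimpleQuotientSelfEquiv : SemisimpleQuotient F F ≃ₐ[F] F :=
  (jacobsonQuotientCongr (AlgEquiv.ofBijective (Algebra.ofId F (nucleus F F))
    ⟨(algebraMap F (nucleus F F)).injective, fun x => ⟨x, Subtype.ext <| by
      rw [Algebra.ofId_apply, nucleus.coe_algebraMap, smul_eq_mul, mul_one]⟩⟩).symm).trans
  ((Ideal.quotientEquivAlgOfEq F (IsSemisimpleRing.jacobson_eq_bot F)).trans
    (AlgEquiv.quotientBot F F))

end Semiassociative

section ClassMonoids

variable (F : Type u) [Field F]

/-- The monoid of isomorphism classes of semiassociative algebras. -/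
def semiassociativeSubmonoid : Submonoid (NonassocClass F) where
  carrier := {c | ∃ A : NonassocAlg F, IsSemiassociative F A.carrier ∧ NonassocClass.mk A = c}
  one_mem' := ⟨⟨F⟩, isSemiassociative_self F, rfl⟩
  mul_mem' := by
    rintro _ _ ⟨A, hA, rfl⟩ ⟨B, hB, rfl⟩
    exact ⟨A.tensor B, hA.tensorProduct hB, rfl⟩

/-- The monoid of isomorphism classes of separable algebras. -/
def separableSubmonoid : Submonoid (AssocClass F) where
  carrier := {c | ∃ R : AssocAlg F, IsSeparableAlgebra F R.carrier ∧ AssocClass.mk R = c}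
  one_mem' := ⟨⟨F⟩, isSeparableAlgebra_self F, rfl⟩
  mul_mem' := by
    rintro _ _ ⟨A, hA, rfl⟩ ⟨B, hB, rfl⟩
    exact ⟨A.tensor B, hA.tensorProduct hB, rfl⟩

variable {F}

theorem mk_mem_semiassociativeSubmonoid {A : NonassocAlg F} :
    NonassocClass.mk A ∈ semiassociativeSubmonoid F ↔ IsSemiassociative F A.carrier := by
  refine ⟨?_, fun h => ⟨A, h, rfl⟩⟩
  rintro ⟨B, hB, hBA⟩
  obtain ⟨e, he⟩ : NonassocIso F B.carrier A.carrier := Quotient.exact hBA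
  exact hB.of_linearEquiv e he

theorem mk_mem_separableSubmonoid {R : AssocAlg F} :
    AssocClass.mk R ∈ separableSubmonoid F ↔ IsSeparableAlgebra F R.carrier := by
  refine ⟨?_, fun h => ⟨R, h, rfl⟩⟩
  rintro ⟨Q, hQ, hQR⟩
  obtain ⟨e⟩ : Nonempty (Q.carrier ≃ₐ[F] R.carrier) := Quotient.exact hQR
  exact .of_surjective (f := e.toAlgHom) e.surjective hQ

variable (F) in
/-- The map `[A] ↦ [σ(A)]` on isomorphism classes of nonassociative algebras. -/
def sigmaClass : NonassocClass F → AssocClass F :=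
  Quotient.lift (fun A => AssocClass.mk A.sigma) fun _ _ ⟨e, he⟩ =>
    Quotient.sound ⟨semisimpleQuotientCongr e he⟩

variable (F) in
/-- The monoid homomorphism `[A] ↦ [σ(A)]` from semiassociative to separable algebras. -/
def sigmaHom : semiassociativeSubmonoid F →* separableSubmonoid F where
  toFun c := ⟨sigmaClass F c.1, by
    obtain ⟨_, A, hA, rfl⟩ := c
    exact ⟨A.sigma, hA.isSeparableAlgebra, rfl⟩⟩
  map_one' := Subtype.ext (Quotient.sound ⟨semisimpleQuotientSelfEquiv F⟩)
  map_mul' := by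
    rintro ⟨_, A, hA, rfl⟩ ⟨_, B, hB, rfl⟩
    exact Subtype.ext
      (Quotient.sound (nonempty_semisimpleQuotient_tensorProduct_algEquiv hA hB))

end ClassMonoids

theorem mainTheorem9 (F : Type u) [Field F] :
    (∀ (A : Type v) (B : Type w)
      [NonAssocRing A] [Module F A] [SMulCommClass F A A] [IsScalarTower F A A]
      [NonAssocRing B] [Module F B] [SMulCommClass F B B] [IsScalarTower F B B],
      IsSemiassociative F A → IsSemiassociative F B →
        radNucleus F (A ⊗[F] B) =
            Submodule.map₂ (TensorProduct.mk F A B) (radNucleus F A) (nucleus F B) ⊔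
              Submodule.map₂ (TensorProduct.mk F A B) (nucleus F A) (radNucleus F B) ∧
          Nonempty (SemisimpleQuotient F (A ⊗[F] B) ≃ₐ[F]
            SemisimpleQuotient F A ⊗[F] SemisimpleQuotient F B)) ∧
    ∃ (M : Submonoid (NonassocClass F)) (S : Submonoid (AssocClass F)) (s : M →* S),
      (∀ A : NonassocAlg F, NonassocClass.mk A ∈ M ↔ IsSemiassociative F A.carrier) ∧
      (∀ R : AssocAlg F, AssocClass.mk R ∈ S ↔ IsSeparableAlgebra F R.carrier) ∧
      ∀ (A : NonassocAlg F) (hA : NonassocClass.mk A ∈ M),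
        (s ⟨NonassocClass.mk A, hA⟩ : AssocClass F) = AssocClass.mk A.sigma :=
  ⟨fun _ _ _ _ _ _ _ _ _ _ hA hB => ⟨hA.radNucleus_tensorProduct hB,
      nonempty_semisimpleQuotient_tensorProduct_algEquiv hA hB⟩,
    semiassociativeSubmonoid F, separableSubmonoid F, sigmaHom F,
    fun _ => mk_mem_semiassociativeSubmonoid, fun _ => mk_mem_separableSubmonoid,
    fun _ _ => rfl⟩
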